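/- Let $Q_1=\chi_{[-1/2,1/2]}$ and $Q_{m+1}=Q_m*Q_1$ for $m\ge 1$, be the centered B-splines on $\mathbb{R}$, and let $\widehat f(w)=\int_{\mathbb{R}} f(x)e^{-2\pi i w x}\,dx$. For $\phi\in L^1(\mathbb{R})\cap L^2(\mathbb{R})$ and $h>0$ put $$B_{\phi,h}(w)=\frac{\sum_{l\in\mathbb{Z}}\left(w+\tfrac{l}{h}\right)^2\left|\widehat\phi\left(w+\tfrac{l}{h}\right)\right|^2}{\sum_{l\in\mathbb{Z}}\left|\widehat\phi\left(w+\tfrac{l}{h}\right)\right|^2},\qquad M_{\phi,h}=\operatorname*{ess\,sup}_{w\in[0,1/h]}B_{\phi,h}(w),$$ and for $\alpha,\beta>0$ let $\mathcal{G}(\phi,\alpha,\beta)=\{e^{2\pi i\beta m\,\cdot}\,\phi(\cdot-\alpha k):k,m\in\mathbb{Z}\}$. This system is a frame for $L^2(\mathbb{R})$ if there are constants $A,B>0$ such that $A\|f\|^2\le\sum_{k,m\in\mathbb{Z}}|\langle f,e^{2\pi i\beta m\,\cdot}\phi(\cdot-\alpha k)\rangle|^2\le B\|f\|^2$ for all $f\in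 L^2(\mathbb{R})$. **Theorem.** Let $0<\beta<2$. Then the two series defining $B_{Q_2,1/\beta}(w)$ converge and the denominator is positive for every $w\in\mathbb{R}$, and, on $[0,\beta]$, the function $B_{Q_2,1/\beta}$ attains its maximum at $w=\beta/2$. Moreover, $$M_{Q_2,1/\beta}=\frac{1}{4\pi^2}\cdot\frac{1-2Q_2\left(\tfrac1\beta\right)+Q_2\left(1-\tfrac1\beta\right)-Q_2\left(1-\tfrac2\beta\right)+Q_2\left(1-\tfrac3\beta\right)}{\tfrac13-Q_4\left(\tfrac1\beta\right)+Q_4\left(\tfrac2\beta\right)-Q_4\left(\tfrac3\beta\right)},$$ and if $0<\alpha<\dfrac{1}{2\sqrt{M_{Q_2,1/\beta}}}$, then $\mathcal{G}(Q_2,\alpha,\beta)$ is a frame for $L^2(\mathbb{R})$. -/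

import Mathlib

open MeasureTheory Set
open scoped FourierTransform

/-- The centered cardinal B-spline of order `m`: `Q₁ = χ_{[-1/2, 1/2]}` and `Q_{m+1} = Q_m * Q₁`.
(Order `0` is not used; it is set to zero.) -/
noncomputable def bspline : ℕ → ℝ → ℝ
  | 0 => 0
  | 1 => indicator (Icc (-(1 / 2) : ℝ) (1 / 2)) 1
  | m + 2 => convolution (bspline (m + 1)) (indicator (Icc (-(1 / 2) : ℝ) (1 / 2)) 1)
      (ContinuousLinearMap.mul ℝ ℝ) volume

/-- The B-spline of order `m` as a complex-valued window. -/
noncomputable def bsplineWindow (m : ℕ) (x : ℝ) : ℂ := (bspline m x : ℂ)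

/-- The terms `(w + l / h)² |φ̂(w + l / h)|²`, `l ∈ ℤ`. -/
noncomputable def bernsteinNumTerm (φ : ℝ → ℂ) (h w : ℝ) (l : ℤ) : ℝ :=
  (w + l / h) ^ 2 * ‖𝓕 φ (w + l / h)‖ ^ 2

/-- The terms `|φ̂(w + l / h)|²`, `l ∈ ℤ`. -/
noncomputable def bernsteinDenTerm (φ : ℝ → ℂ) (h w : ℝ) (l : ℤ) : ℝ :=
  ‖𝓕 φ (w + l / h)‖ ^ 2

/-- `B_{φ,h}(w) = (∑_l (w + l/h)² |φ̂(w + l/h)|²) / (∑_l |φ̂(w + l/h)|²)`. -/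
noncomputable def bernsteinRatio (φ : ℝ → ℂ) (h w : ℝ) : ℝ :=
  (∑' l : ℤ, bernsteinNumTerm φ h w l) / ∑' l : ℤ, bernsteinDenTerm φ h w l

/-- `M_{φ,h}`, the essential supremum of `B_{φ,h}` on `[0, 1/h]`. -/
noncomputable def bernsteinConst (φ : ℝ → ℂ) (h : ℝ) : ℝ :=
  essSup (bernsteinRatio φ h) (volume.restrict (Icc 0 (1 / h)))

/-- A family `e` in a Hilbert space is a frame if there are constants `A, B > 0` with
`A ‖f‖² ≤ ∑ |⟨f, e i⟩|² ≤ B ‖f‖²` for every `f`. -/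
def IsHilbertFrame {ι H : Type*} [NormedAddCommGroup H] [InnerProductSpace ℂ H]
    (e : ι → H) : Prop :=
  ∃ A B : ℝ, 0 < A ∧ 0 < B ∧ ∀ f : H,
    Summable (fun i => ‖inner ℂ (e i) f‖ ^ 2) ∧
    A * ‖f‖ ^ 2 ≤ ∑' i, ‖inner ℂ (e i) f‖ ^ 2 ∧
    ∑' i, ‖inner ℂ (e i) f‖ ^ 2 ≤ B * ‖f‖ ^ 2

/-- The time-frequency shift `x ↦ e^{2πi β m x} φ(x - α k)`. -/
noncomputable def gaborAtom (φ : ℝ → ℂ) (α β : ℝ) (k m : ℤ) (x : ℝ) : ℂ :=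
  Complex.exp (2 * Real.pi * Complex.I * β * m * x) * φ (x - α * k)

/-- The Gabor system `𝒢(φ, α, β) = {e^{2πi β m ·} φ(· - α k) : k, m ∈ ℤ}` lies in `L²(ℝ)` and is a
frame for it. -/
def IsGaborFrame (φ : ℝ → ℂ) (α β : ℝ) : Prop :=
  ∃ hL2 : ∀ k m : ℤ, MemLp (gaborAtom φ α β k m) 2 volume,
    IsHilbertFrame (fun p : ℤ × ℤ => (hL2 p.1 p.2).toLp (gaborAtom φ α β p.1 p.2))

/-!
The window is the hat function `φ = Q₂`, with `φ̂ (w) = sinc (π w) ^ 2`.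

*The maximum of the ratio.* The autocorrelation of `φ` is `Q₄`, and that of `φ'` is
`q = -Q₄'' = 2 Q₂ - Q₂ (· - 1) - Q₂ (· + 1)`. Both vanish off `(-2, 2)`, so by Poisson summation
(`tsum_fourier_shift`) and `β < 2` the two series of the Bernstein ratio are, up to constants, the
cubic cosine polynomials `∑_{|n| ≤ 3} q (n / β) cos (n θ)` and `∑_{|n| ≤ 3} Q₄ (n / β) cos (n θ)`
at `θ = 2 π w / β`. That their quotient is largest at `θ = π` becomes, after division by
`1 + cos θ`, a polynomial inequality in `cos θ` and `1 / β` (`samplePoly_mul_le`); evaluating at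
`θ = π` gives the formula for `M`.

*The frame property.* For continuous, compactly supported `f`, Parseval's identity applied to the
`1 / β`-periodizations of `f φ (· - α k)` gives
`∑_{k, m} |⟨f, e^{2πi β m ·} φ (· - α k)⟩|² =
  (1 / β) ∫_0^{1 / β} ∑_k |∑_l f (x + l / β) φ (x + l / β - α k)|² dx`
(`hasSum_sq_gabor_coeff`). It therefore suffices to bound `∑_k |F (x - α k)|²` from above and below
by multiples of `∑ |c_l|²` for the splines `F = ∑ c_l φ (· + l / β)` with finitely many terms; real
coefficients are enough. A Toeplitz form whose symbol is nonnegative is nonnegative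
(`toeplitz_form_nonneg`), so the pointwise inequalities between the two cosine polynomials yield
`‖F'‖² ≤ 4 π² M ‖F‖²` and `‖F‖² ≥ κ ∑ c_l²`. By Wirtinger's inequality on the intervals of length
`α` centered at the sampling points, the step function through the samples of `F` differs from `F`
in norm by at most `(α / π) ‖F'‖ ≤ 2 α √M ‖F‖`, which is a proper fraction of `‖F‖`
(`exists_sampling_lower_bound`). A density argument (`isHilbertFrame_of_dense`) extends the frame
inequalities to all of `L²`.
-/

/-! ### Explicit form of the B-splines -/

/-- The unit box, which is the B-spline of order one. -/
noncomputable def unitBox : ℝ → ℝ := indicator (Icc (-(1 / 2) : ℝ) (1 / 2)) 1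

theorem integrable_unitBox : Integrable unitBox := by
  unfold unitBox
  exact (integrable_indicator_iff measurableSet_Icc).2 (integrableOn_const (by simp))

theorem unitBox_neg (x : ℝ) : unitBox (-x) = unitBox x := by
  unfold unitBox
  simp only [indicator, mem_Icc, Pi.one_apply]
  congr 1
  apply propext
  constructor <;> rintro ⟨h1, h2⟩ <;> constructor <;> linarith

theorem bspline_one : bspline 1 = unitBox := rfl

theorem bspline_add_two (m : ℕ) :
    bspline (m + 2) =
      convolution (bspline (m + 1)) unitBox (ContinuousLinearMap.mul ℝ ℝ) volume := rfl

/-- Convolution with the unit box is integration over a centered window of length one. -/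
theorem convolution_unitBox (f : ℝ → ℝ) (x : ℝ) :
    convolution f unitBox (ContinuousLinearMap.mul ℝ ℝ) volume x
      = ∫ t in (x - 1 / 2)..(x + 1 / 2), f t := by
  rw [intervalIntegral.integral_of_le (by linarith), ← integral_Icc_eq_integral_Ioc,
    ← integral_indicator measurableSet_Icc]
  unfold convolution unitBox
  congr 1
  ext t
  simp only [ContinuousLinearMap.mul_apply', indicator, mem_Icc, Pi.one_apply, mul_ite, mul_one,
    mul_zero]
  congr 1
  apply propext
  constructor <;> rintro ⟨h1, h2⟩ <;> constructor <;> linarith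

theorem bspline_two (x : ℝ) : bspline 2 x = max 0 (1 - |x|) := by
  rw [bspline_add_two 0, convolution_unitBox, bspline_one, unitBox,
    intervalIntegral.integral_of_le (by linarith), ← integral_Icc_eq_integral_Ioc,
    integral_indicator measurableSet_Icc, Measure.restrict_restrict measurableSet_Icc,
    Icc_inter_Icc]
  simp only [Pi.one_apply, integral_const, smul_eq_mul, mul_one, measureReal_restrict_apply_univ]
  rw [Real.volume_real_Icc, max_comm]
  congr 1
  rcases abs_cases x with ⟨h, h'⟩ | ⟨h, h'⟩ <;> rw [h]
  · rw [min_eq_left (by linarith), max_eq_right (by linarith)]; ring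
  · rw [min_eq_right (by linarith), max_eq_left (by linarith)]; ring

theorem bspline_two_neg (x : ℝ) : bspline 2 (-x) = bspline 2 x := by
  simp [bspline_two]

theorem continuous_bspline_two : Continuous (bspline 2) := by
  have : bspline 2 = fun x => max 0 (1 - |x|) := funext bspline_two
  rw [this]; fun_prop

theorem bspline_two_nonneg (x : ℝ) : 0 ≤ bspline 2 x := by
  rw [bspline_two]; exact le_max_left _ _

theorem bspline_two_le_one (x : ℝ) : bspline 2 x ≤ 1 := by
  rw [bspline_two]; exact max_le zero_le_one (by linarith [abs_nonneg x])

theorem bspline_two_eq_zero {x : ℝ} (h : 1 ≤ |x|) : bspline 2 x = 0 := by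
  rw [bspline_two]; exact max_eq_left (by linarith)

/-- The integral of a shifted truncated power. -/
theorem integral_truncated_pow (n : ℕ) (hn : 1 ≤ n) (c a b : ℝ) :
    ∫ t in a..b, (max (t + c) 0) ^ n
      = ((max (b + c) 0) ^ (n + 1) - (max (a + c) 0) ^ (n + 1)) / (n + 1) := by
  have hn' : ((n : ℝ) + 1) ≠ 0 := by positivity
  have := integral_eq_of_hasDerivAt_off_countable (fun t : ℝ => (max (t + c) 0) ^ (n + 1) / (n + 1))
    (fun t : ℝ => (max (t + c) 0) ^ n) (a := a) (b := b) (s := {-c}) (countable_singleton _)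
    (by fun_prop) ?_ (Continuous.intervalIntegrable (by fun_prop) _ _)
  · rw [this]; ring
  · rintro t ⟨-, ht⟩
    have ht : t ≠ -c := ht
    rcases lt_or_gt_of_ne ht with h | h
    · have h0 : max (t + c) 0 = 0 := max_eq_right (by linarith)
      rw [h0, zero_pow (by omega)]
      refine (hasDerivAt_const t (0 : ℝ)).congr_of_eventuallyEq ?_
      filter_upwards [Iio_mem_nhds h] with u hu
      have hu : u < -c := hu
      rw [max_eq_right (by linarith), zero_pow (by omega), zero_div]
    · have h0 : max (t + c) 0 = t + c := max_eq_left (by linarith)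
      rw [h0]
      have h1 : HasDerivAt (fun u : ℝ => (u + c) ^ (n + 1) / (n + 1)) ((t + c) ^ n) t := by
        have := (((hasDerivAt_id t).add_const c).pow (n + 1)).div_const ((n : ℝ) + 1)
        simp only [id, Nat.add_sub_cancel, mul_one] at this
        convert! this using 1
        push_cast
        field_simp
      refine h1.congr_of_eventuallyEq ?_
      filter_upwards [Ioi_mem_nhds h] with u hu
      have hu : -c < u := hu
      rw [max_eq_left (by linarith)]

theorem bspline_two_eq_truncated (x : ℝ) :
    bspline 2 x = (max (x + 1) 0) ^ 1 - 2 * (max (x + 0) 0) ^ 1 + (max (x + -1) 0) ^ 1 := by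
  rw [bspline_two, pow_one, pow_one, pow_one]
  rcases max_cases (x + 1) 0 with h1 | h1 <;> rcases max_cases (x + 0) 0 with h2 | h2 <;>
    rcases max_cases (x + -1) 0 with h3 | h3 <;> rcases abs_cases x with h4 | h4 <;>
    rcases max_cases 0 (1 - |x|) with h5 | h5 <;> linarith

theorem bspline_three_eq_truncated (x : ℝ) :
    bspline 3 x = ((max (x + 3 / 2) 0) ^ 2 - 3 * (max (x + 1 / 2) 0) ^ 2
      + 3 * (max (x + -(1 / 2)) 0) ^ 2 - (max (x + -(3 / 2)) 0) ^ 2) / 2 := by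
  rw [bspline_add_two 1, convolution_unitBox]
  have hi (c : ℝ) : IntervalIntegrable (fun t : ℝ => (max (t + c) 0) ^ 1) volume
      (x - 1 / 2) (x + 1 / 2) := Continuous.intervalIntegrable (by fun_prop) _ _
  rw [show bspline (1 + 1) = _ from funext bspline_two_eq_truncated]
  rw [intervalIntegral.integral_add ((hi _).sub ((hi _).const_mul _)) (hi _),
    intervalIntegral.integral_sub (hi _) ((hi _).const_mul _),
    intervalIntegral.integral_const_mul, integral_truncated_pow 1 le_rfl,
    integral_truncated_pow 1 le_rfl, integral_truncated_pow 1 le_rfl]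
  ring_nf

theorem bspline_four_eq_truncated (x : ℝ) :
    bspline 4 x = ((max (x + 2) 0) ^ 3 - 4 * (max (x + 1) 0) ^ 3 + 6 * (max (x + 0) 0) ^ 3
      - 4 * (max (x + -1) 0) ^ 3 + (max (x + -2) 0) ^ 3) / 6 := by
  rw [bspline_add_two 2, convolution_unitBox]
  have hi (c : ℝ) : IntervalIntegrable (fun t : ℝ => (max (t + c) 0) ^ 2) volume
      (x - 1 / 2) (x + 1 / 2) := Continuous.intervalIntegrable (by fun_prop) _ _
  rw [show bspline (2 + 1) = _ from funext bspline_three_eq_truncated]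
  rw [intervalIntegral.integral_div, intervalIntegral.integral_sub
      (((hi _).sub ((hi _).const_mul _)).add ((hi _).const_mul _)) (hi _),
    intervalIntegral.integral_add ((hi _).sub ((hi _).const_mul _)) ((hi _).const_mul _),
    intervalIntegral.integral_sub (hi _) ((hi _).const_mul _),
    intervalIntegral.integral_const_mul, intervalIntegral.integral_const_mul,
    integral_truncated_pow 2 one_le_two,
    integral_truncated_pow 2 one_le_two, integral_truncated_pow 2 one_le_two,
    integral_truncated_pow 2 one_le_two]
  ring_nf

theorem continuous_bspline_four : Continuous (bspline 4) := by
  rw [funext bspline_four_eq_truncated]; fun_prop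

theorem bspline_four_of_nonneg_of_le_one {x : ℝ} (h0 : 0 ≤ x) (h1 : x ≤ 1) :
    bspline 4 x = (4 - 6 * x ^ 2 + 3 * x ^ 3) / 6 := by
  rw [bspline_four_eq_truncated, max_eq_left (by linarith : 0 ≤ x + 2),
    max_eq_left (by linarith : 0 ≤ x + 1), max_eq_left (by linarith : 0 ≤ x + 0),
    max_eq_right (by linarith : x + -1 ≤ 0), max_eq_right (by linarith : x + -2 ≤ 0)]
  ring

theorem bspline_four_of_one_le_of_le_two {x : ℝ} (h0 : 1 ≤ x) (h1 : x ≤ 2) :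
    bspline 4 x = (2 - x) ^ 3 / 6 := by
  rw [bspline_four_eq_truncated, max_eq_left (by linarith : 0 ≤ x + 2),
    max_eq_left (by linarith : 0 ≤ x + 1), max_eq_left (by linarith : 0 ≤ x + 0),
    max_eq_left (by linarith : 0 ≤ x + -1), max_eq_right (by linarith : x + -2 ≤ 0)]
  ring

theorem bspline_four_of_two_le {x : ℝ} (h0 : 2 ≤ x) : bspline 4 x = 0 := by
  rw [bspline_four_eq_truncated, max_eq_left (by linarith : 0 ≤ x + 2),
    max_eq_left (by linarith : 0 ≤ x + 1), max_eq_left (by linarith : 0 ≤ x + 0),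
    max_eq_left (by linarith : 0 ≤ x + -1), max_eq_left (by linarith : 0 ≤ x + -2)]
  ring

theorem bspline_four_neg (x : ℝ) : bspline 4 (-x) = bspline 4 x := by
  have key (y : ℝ) : max (-y) 0 ^ 3 = max y 0 ^ 3 - y ^ 3 := by
    rcases le_total y 0 with h | h
    · rw [max_eq_left (by linarith), max_eq_right h]; ring
    · rw [max_eq_right (by linarith), max_eq_left h]; ring
  have k1 := key (x + 2)
  have k2 := key (x + 1)
  have k3 := key (x + 0)
  have k4 := key (x + -1)
  have k5 := key (x + -2)
  rw [bspline_four_eq_truncated, bspline_four_eq_truncated]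
  rw [show -x + 2 = -(x + -2) by ring, show -x + 1 = -(x + -1) by ring,
    show -x + 0 = -(x + 0) by ring, show -x + -1 = -(x + 1) by ring,
    show -x + -2 = -(x + 2) by ring, k1, k2, k3, k4, k5]
  ring

theorem bspline_four_eq_zero {x : ℝ} (h : 2 ≤ |x|) : bspline 4 x = 0 := by
  rcases abs_cases x with ⟨h1, -⟩ | ⟨h1, -⟩
  · exact bspline_four_of_two_le (h1 ▸ h)
  · rw [← bspline_four_neg]; exact bspline_four_of_two_le (h1 ▸ h)

/-! ### Autocorrelations -/

theorem hasCompactSupport_bspline_two : HasCompactSupport (bspline 2) := by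
  refine HasCompactSupport.of_support_subset_isCompact (isCompact_Icc (a := -1) (b := 1)) ?_
  intro x hx
  by_contra h
  apply hx
  apply bspline_two_eq_zero
  rw [mem_Icc, ← abs_le] at h
  exact (not_le.1 h).le

theorem integrable_bspline_two : Integrable (bspline 2) :=
  continuous_bspline_two.integrable_of_hasCompactSupport hasCompactSupport_bspline_two

/-- `Q₂ * Q₂ = Q₄`, by associativity of convolution. -/
theorem convolution_bspline_two_self (x : ℝ) :
    convolution (bspline 2) (bspline 2) (ContinuousLinearMap.mul ℝ ℝ) volume x = bspline 4 x := by
  have hb : (fun x => ‖unitBox x‖) = unitBox := by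
    ext x
    rw [Real.norm_of_nonneg]
    exact indicator_nonneg (fun _ _ => zero_le_one) _
  have hh : (fun x => ‖bspline 2 x‖) = bspline 2 := by
    ext x
    rw [Real.norm_of_nonneg (bspline_two_nonneg x)]
  symm
  change convolution (convolution (bspline 2) unitBox _ volume) unitBox _ volume x
    = convolution (bspline 2) (convolution unitBox unitBox _ volume) _ volume x
  refine convolution_assoc _ _ _ _ (fun x y z => by simp [mul_assoc])
    integrable_bspline_two.1 integrable_unitBox.1 integrable_unitBox.1
    (integrable_bspline_two.ae_convolution_exists _ integrable_unitBox) ?_ ?_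
  · rw [hb]; exact integrable_unitBox.ae_convolution_exists _ integrable_unitBox
  · rw [hh, hb]
    change ConvolutionExistsAt (bspline 2) (bspline 2) x _ _
    exact hasCompactSupport_bspline_two.convolutionExists_right _
      integrable_bspline_two.locallyIntegrable continuous_bspline_two x

theorem integral_mul_shift_eq_convolution (f : ℝ → ℝ) (hf : ∀ x, f (-x) = f x) (a b : ℝ) :
    ∫ t, f (t + a) * f (t + b)
      = convolution f f (ContinuousLinearMap.mul ℝ ℝ) volume (a - b) := by
  rw [← integral_sub_right_eq_self _ a]
  unfold convolution
  congr 1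
  ext t
  rw [ContinuousLinearMap.mul_apply', ← hf (a - b - t)]
  ring_nf

theorem integral_bspline_two_mul_shift (a b : ℝ) :
    ∫ t, bspline 2 (t + a) * bspline 2 (t + b) = bspline 4 (a - b) := by
  rw [integral_mul_shift_eq_convolution _ bspline_two_neg, convolution_bspline_two_self]

theorem integral_unitBox_mul_shift (a b : ℝ) :
    ∫ t, unitBox (t + a) * unitBox (t + b) = bspline 2 (a - b) := by
  rw [integral_mul_shift_eq_convolution _ unitBox_neg, ← bspline_one, bspline_add_two 0]
  rfl

theorem integrable_unitBox_mul_shift (a b : ℝ) :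
    Integrable fun t => unitBox (t + a) * unitBox (t + b) := by
  refine (integrable_unitBox.comp_add_right b).bdd_mul (c := 1)
    (integrable_unitBox.comp_add_right a).1 (Filter.Eventually.of_forall fun t => ?_)
  unfold unitBox indicator
  split_ifs <;> simp

/-- The almost everywhere derivative of the hat function `bspline 2`. -/
noncomputable def hatDeriv (x : ℝ) : ℝ := unitBox (x + 1 / 2) - unitBox (x - 1 / 2)

/-- The negative of the second derivative of `bspline 4`, that is, the autocorrelation of the
derivative of `bspline 2`. -/
noncomputable def negSecondDiff (x : ℝ) : ℝ :=
  2 * bspline 2 x - bspline 2 (x - 1) - bspline 2 (x + 1)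

theorem continuous_negSecondDiff : Continuous negSecondDiff := by
  have := continuous_bspline_two
  unfold negSecondDiff; fun_prop

theorem negSecondDiff_neg (x : ℝ) : negSecondDiff (-x) = negSecondDiff x := by
  unfold negSecondDiff
  rw [← bspline_two_neg (-x - 1), ← bspline_two_neg (-x + 1), bspline_two_neg x,
    show -(-x - 1) = x + 1 by ring, show -(-x + 1) = x - 1 by ring]
  ring

theorem negSecondDiff_eq_zero {x : ℝ} (h : 2 ≤ |x|) : negSecondDiff x = 0 := by
  unfold negSecondDiff
  have h1 : 1 ≤ |x| := by linarith
  have h2 : 1 ≤ |x - 1| := by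
    rcases abs_cases x with h' | h' <;> rcases abs_cases (x - 1) with h'' | h'' <;> linarith
  have h3 : 1 ≤ |x + 1| := by
    rcases abs_cases x with h' | h' <;> rcases abs_cases (x + 1) with h'' | h'' <;> linarith
  rw [bspline_two_eq_zero h1, bspline_two_eq_zero h2, bspline_two_eq_zero h3]; ring

theorem integrable_hatDeriv_mul_shift (a b : ℝ) :
    Integrable fun t => hatDeriv (t + a) * hatDeriv (t + b) := by
  have h (c d : ℝ) := integrable_unitBox_mul_shift (a + c) (b + d)
  refine ((((h (1 / 2) (1 / 2)).sub (h (1 / 2) (-(1 / 2)))).sub (h (-(1 / 2)) (1 / 2))).add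
    (h (-(1 / 2)) (-(1 / 2)))).congr (Filter.Eventually.of_forall fun t => ?_)
  simp only [hatDeriv, Pi.add_apply, Pi.sub_apply, ← add_assoc, ← sub_eq_add_neg]
  ring_nf

theorem integral_hatDeriv_mul_shift (a b : ℝ) :
    ∫ t, hatDeriv (t + a) * hatDeriv (t + b) = negSecondDiff (a - b) := by
  have h (c d : ℝ) := integrable_unitBox_mul_shift (a + c) (b + d)
  have e : (fun t => hatDeriv (t + a) * hatDeriv (t + b)) = fun t =>
      unitBox (t + (a + 1 / 2)) * unitBox (t + (b + 1 / 2))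
      - unitBox (t + (a + 1 / 2)) * unitBox (t + (b + -(1 / 2)))
      - unitBox (t + (a + -(1 / 2))) * unitBox (t + (b + 1 / 2))
      + unitBox (t + (a + -(1 / 2))) * unitBox (t + (b + -(1 / 2))) := by
    ext t
    simp only [hatDeriv, ← add_assoc, ← sub_eq_add_neg]
    ring_nf
  have h12 := (h (1 / 2) (1 / 2)).sub (h (1 / 2) (-(1 / 2)))
  have h123 := h12.sub (h (-(1 / 2)) (1 / 2))
  rw [e]
  refine (integral_add h123 (h _ _)).trans ?_
  rw [integral_sub' h12 (h _ _), integral_sub' (h _ _) (h _ _)]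
  simp only [integral_unitBox_mul_shift, negSecondDiff]
  ring_nf

/-! ### Fourier transforms of the B-splines -/

theorem fourier_ofReal_unitBox (w : ℝ) :
    𝓕 (fun x => (unitBox x : ℂ)) w = (Real.sinc (Real.pi * w) : ℝ) := by
  have hpi := Real.pi_pos
  rw [Real.fourier_real_eq_integral_exp_smul]
  have e1 : (fun v : ℝ => Complex.exp (↑(-2 * Real.pi * v * w) * Complex.I) • (unitBox v : ℂ))
      = indicator (Icc (-(1 / 2) : ℝ) (1 / 2))
        (fun v : ℝ => Complex.exp (↑(-2 * Real.pi * w * v) * Complex.I)) := by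
    ext v
    unfold unitBox indicator
    split_ifs
    · simp; ring_nf
    · simp
  rw [e1, integral_indicator measurableSet_Icc, integral_Icc_eq_integral_Ioc,
    ← intervalIntegral.integral_of_le (by norm_num)]
  rcases eq_or_ne w 0 with rfl | hw
  · simp; norm_num
  · have := intervalIntegral.integral_comp_mul_left
      (fun t : ℝ => Complex.exp (t * Complex.I)) (a := -(1 / 2)) (b := 1 / 2)
      (c := -2 * Real.pi * w) (by positivity)
    rw [this, show -2 * Real.pi * w * -(1 / 2) = Real.pi * w by ring,
      show -2 * Real.pi * w * (1 / 2) = -(Real.pi * w) by ring, intervalIntegral.integral_symm,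
      integral_exp_mul_I_eq_sinc]
    have hp : (Real.pi : ℂ) ≠ 0 := by exact_mod_cast hpi.ne'
    have hw' : (w : ℂ) ≠ 0 := by exact_mod_cast hw
    rw [Complex.real_smul]
    push_cast
    field_simp

/-- Real convolution becomes multiplication after Fourier transform. -/
theorem fourier_ofReal_convolution {f g : ℝ → ℝ} (hf : Integrable f) (hg : Integrable g) (w : ℝ) :
    𝓕 (fun x => ((convolution f g (ContinuousLinearMap.mul ℝ ℝ) volume x : ℝ) : ℂ)) w
      = 𝓕 (fun x => (f x : ℂ)) w * 𝓕 (fun x => (g x : ℂ)) w := by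
  have hf' : Integrable fun x => (f x : ℂ) := hf.ofReal
  have hg' : Integrable fun x => (g x : ℂ) := hg.ofReal
  have e : (fun x => ((convolution f g (ContinuousLinearMap.mul ℝ ℝ) volume x : ℝ) : ℂ))
      = convolution (fun x => (f x : ℂ)) (fun x => (g x : ℂ))
        (ContinuousLinearMap.mul ℂ ℂ) volume := by
    ext x
    unfold convolution
    rw [← integral_complex_ofReal]
    simp
  rw [e, Real.fourier_mul_convolution_eq hf' hg' w]

theorem fourier_bspline_two (w : ℝ) :
    𝓕 (fun x => (bspline 2 x : ℂ)) w = ((Real.sinc (Real.pi * w)) ^ 2 : ℝ) := by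
  have := fourier_ofReal_convolution integrable_unitBox integrable_unitBox w
  rw [fourier_ofReal_unitBox] at this
  rw [bspline_add_two 0, show bspline (0 + 1) = unitBox from rfl, this]
  push_cast; ring

theorem fourier_bspline_four (w : ℝ) :
    𝓕 (fun x => (bspline 4 x : ℂ)) w = ((Real.sinc (Real.pi * w)) ^ 4 : ℝ) := by
  have := fourier_ofReal_convolution integrable_bspline_two integrable_bspline_two w
  simp_rw [convolution_bspline_two_self] at this
  rw [this, fourier_bspline_two]
  push_cast; ring

theorem mul_sinc (x : ℝ) : x * Real.sinc x = Real.sin x := by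
  rcases eq_or_ne x 0 with rfl | hx
  · simp
  · rw [Real.sinc_of_ne_zero hx]; field_simp

theorem fourier_comp_add_right (f : ℝ → ℂ) (a w : ℝ) :
    𝓕 (fun x => f (x + a)) w = Complex.exp (↑(2 * Real.pi * a * w) * Complex.I) * 𝓕 f w := by
  rw [Real.fourier_real_eq_integral_exp_smul, Real.fourier_real_eq_integral_exp_smul,
    ← integral_const_mul, ← integral_sub_right_eq_self _ a]
  congr 1
  ext x
  rw [smul_eq_mul, smul_eq_mul, ← mul_assoc, ← Complex.exp_add, sub_add_cancel]
  congr 2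
  push_cast; ring

theorem fourier_negSecondDiff (w : ℝ) :
    𝓕 (fun x => (negSecondDiff x : ℂ)) w
      = (4 * Real.pi ^ 2 * (w ^ 2 * (Real.sinc (Real.pi * w)) ^ 4) : ℝ) := by
  have hi : Integrable fun x => (bspline 2 x : ℂ) := integrable_bspline_two.ofReal
  have key : 𝓕 (fun x => (negSecondDiff x : ℂ)) w
      = 2 * 𝓕 (fun x => (bspline 2 x : ℂ)) w
        - 𝓕 (fun x => (bspline 2 (x + -1) : ℂ)) w - 𝓕 (fun x => (bspline 2 (x + 1) : ℂ)) w := by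
    have hF (g : ℝ → ℂ) (hg : Integrable g) : Integrable (fun v : ℝ =>
        Complex.exp (↑(-2 * Real.pi * v * w) * Complex.I) • g v) := by
      refine hg.bdd_mul (c := 1) (Continuous.aestronglyMeasurable (by fun_prop))
        (Filter.Eventually.of_forall fun v => ?_)
      rw [Complex.norm_exp_ofReal_mul_I]
    simp only [Real.fourier_real_eq_integral_exp_smul]
    have h1 := (hF _ hi).const_mul 2
    have h2 := hF _ (hi.comp_add_right (-1))
    have h3 := hF _ (hi.comp_add_right 1)
    rw [← integral_const_mul, ← integral_sub h1 h2]
    refine Eq.trans ?_ (integral_sub (h1.sub h2) h3)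
    congr 1
    ext v
    simp only [negSecondDiff, smul_eq_mul, sub_eq_add_neg]
    push_cast
    ring
  rw [key, fourier_comp_add_right (fun x => (bspline 2 x : ℂ)),
    fourier_comp_add_right (fun x => (bspline 2 x : ℂ)), fourier_bspline_two]
  have hs := mul_sinc (Real.pi * w)
  have e : (4 * Real.pi ^ 2 * (w ^ 2 * (Real.sinc (Real.pi * w)) ^ 4) : ℝ)
      = 4 * (Real.sin (Real.pi * w)) ^ 2 * (Real.sinc (Real.pi * w)) ^ 2 := by
    rw [← hs]; ring
  rw [e, Complex.exp_mul_I, Complex.exp_mul_I, ← Complex.ofReal_cos, ← Complex.ofReal_cos,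
    ← Complex.ofReal_sin, ← Complex.ofReal_sin,
    show 2 * Real.pi * -1 * w = -(2 * (Real.pi * w)) by ring,
    show 2 * Real.pi * 1 * w = 2 * (Real.pi * w) by ring, Real.cos_neg, Real.sin_neg,
    Real.cos_two_mul, Real.cos_sq']
  push_cast
  ring

/-! ### Poisson summation for compactly supported functions -/

theorem summable_inv_one_add_sq_shift {β : ℝ} (hβ : 0 < β) (w : ℝ) :
    Summable fun n : ℤ => 1 / (1 + (w + n * β) ^ 2) := by
  have h0 : Summable fun n : ℤ => (1 + (2 + 2 * w ^ 2) / β ^ 2) * (1 / (n : ℝ) ^ 2) :=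
    (Real.summable_one_div_int_pow.2 one_lt_two).mul_left _
  refine summable_of_isBigO h0 ?_
  refine Asymptotics.IsBigO.of_bound 1 ?_
  filter_upwards [(Set.finite_singleton (0 : ℤ)).compl_mem_cofinite] with n hn
  have hn0 : (n : ℝ) ≠ 0 := by exact_mod_cast hn
  have hn2 : 0 < (n : ℝ) ^ 2 := by positivity
  rw [Real.norm_of_nonneg (by positivity), Real.norm_of_nonneg (by positivity), one_mul,
    mul_one_div, div_le_div_iff₀ (by positivity) hn2]
  have hb : (n : ℝ) ^ 2 = ((n : ℝ) * β) ^ 2 / β ^ 2 := by field_simp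
  have h1 : ((n : ℝ) * β) ^ 2 ≤ 2 * (w + n * β) ^ 2 + 2 * w ^ 2 := by
    nlinarith [sq_nonneg (2 * w + n * β)]
  have h2 : ((n : ℝ) * β) ^ 2 ≤ (2 + 2 * w ^ 2) * (1 + (w + n * β) ^ 2) := by
    nlinarith [mul_nonneg (sq_nonneg w) (sq_nonneg (w + n * β))]
  calc 1 * (n : ℝ) ^ 2 = ((n : ℝ) * β) ^ 2 / β ^ 2 := by rw [one_mul, ← hb]
    _ ≤ (2 + 2 * w ^ 2) * (1 + (w + n * β) ^ 2) / β ^ 2 := by gcongr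
    _ ≤ (1 + (2 + 2 * w ^ 2) / β ^ 2) * (1 + (w + n * β) ^ 2) := by
        rw [mul_div_right_comm]
        exact mul_le_mul_of_nonneg_right (by linarith) (by positivity)

/-- Poisson summation over the lattice `β ℤ`, shifted by `w`, for a function vanishing off
`(-2, 2)`. -/
theorem tsum_fourier_shift {f : ℝ → ℂ} (hc : Continuous f) (hs : ∀ x, 2 ≤ |x| → f x = 0)
    {β : ℝ} (hβ : 0 < β) (w : ℝ) (hF : Summable fun n : ℤ => 𝓕 f (w + n * β)) :
    β * ∑' n : ℤ, 𝓕 f (w + n * β)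
      = ∑' n : ℤ, f (n / β) * Complex.exp (↑(-2 * Real.pi * (n / β) * w) * Complex.I) := by
  set g : ℝ → ℂ := fun x =>
    f (x / β) * Complex.exp (↑(-2 * Real.pi * (x / β) * w) * Complex.I) with hg
  have hgc : Continuous g := by fun_prop
  have hFg (v : ℝ) : 𝓕 g v = β * 𝓕 f (w + v * β) := by
    rw [Real.fourier_real_eq_integral_exp_smul, Real.fourier_real_eq_integral_exp_smul]
    have := Measure.integral_comp_div (fun u : ℝ =>
      Complex.exp (↑(-2 * Real.pi * u * (w + v * β)) * Complex.I) • f u) β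
    rw [abs_of_pos hβ, Complex.real_smul] at this
    rw [← this]
    congr 1
    ext x
    simp only [hg, smul_eq_mul]
    rw [mul_comm (f (x / β)), ← mul_assoc, ← Complex.exp_add]
    congr 2
    have : (β : ℂ) ≠ 0 := by exact_mod_cast hβ.ne'
    push_cast
    field_simp
    ring
  have hdecay : g =O[Filter.cocompact ℝ] fun x : ℝ => |x| ^ (-2 : ℝ) := by
    have hz : g =ᶠ[Filter.cocompact ℝ] fun _ => 0 := by
      filter_upwards [(isCompact_Icc (a := -(2 * β)) (b := 2 * β)).compl_mem_cocompact] with x hx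
      have : 2 ≤ |x / β| := by
        rw [abs_div, abs_of_pos hβ, le_div_iff₀ hβ]
        rw [mem_compl_iff, mem_Icc, ← abs_le] at hx
        exact (not_le.1 hx).le
      simp [hg, hs _ this]
    exact hz.trans_isBigO (Asymptotics.isBigO_zero _ _)
  have := Real.tsum_eq_tsum_fourier_of_rpow_decay_of_summable hgc one_lt_two hdecay
    (by simpa only [hFg] using hF.mul_left (β : ℂ)) 0
  simp only [hFg, zero_add, QuotientAddGroup.mk_zero, fourier_eval_zero, mul_one] at this
  rw [← tsum_mul_left, ← this]

/-- The trigonometric polynomial `∑_{|n| ≤ 3} a (n s) cos (n θ)` built from the samples of `a` on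
the lattice `s ℤ`. -/
noncomputable def samplePoly (a : ℝ → ℝ) (s θ : ℝ) : ℝ :=
  ∑ n ∈ Finset.Icc (-3 : ℤ) 3, a (n * s) * Real.cos (n * θ)

theorem samplePoly_eq {a : ℝ → ℝ} (ha : ∀ x, a (-x) = a x) (s θ : ℝ) :
    samplePoly a s θ = a 0 + 2 * (a s * Real.cos θ + a (2 * s) * Real.cos (2 * θ)
      + a (3 * s) * Real.cos (3 * θ)) := by
  have h : Finset.Icc (-3 : ℤ) 3 = {-3, -2, -1, 0, 1, 2, 3} := by decide
  rw [samplePoly, h]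
  simp only [Finset.mem_insert, Finset.mem_singleton, Finset.sum_insert, Finset.sum_singleton,
    Int.reduceNeg, Int.reduceEq, or_self, not_false_eq_true]
  push_cast
  simp only [neg_mul, ha, Real.cos_neg, zero_mul, one_mul, Real.cos_zero]
  ring

/-- Samples at `n / β` with `|n| ≥ 4` miss the interval `(-2, 2)` because `β < 2`, so that
Poisson summation yields a trigonometric polynomial of degree three. -/
theorem tsum_fourier_eq_samplePoly {f g : ℝ → ℝ} (hc : Continuous f)
    (hs : ∀ x, 2 ≤ |x| → f x = 0) (hfg : ∀ v, 𝓕 (fun x => (f x : ℂ)) v = (g v : ℂ))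
    {β : ℝ} (hβ : 0 < β) (hβ2 : β < 2) (w : ℝ) (hF : Summable fun n : ℤ => g (w + n * β)) :
    β * ∑' n : ℤ, g (w + n * β) = samplePoly f (1 / β) (2 * Real.pi * w / β) := by
  have hF' : Summable fun n : ℤ => 𝓕 (fun x => (f x : ℂ)) (w + n * β) := by
    simp only [hfg]
    exact_mod_cast hF
  have h := tsum_fourier_shift (f := fun x => (f x : ℂ)) (by fun_prop)
    (fun x hx => by rw [hs x hx, Complex.ofReal_zero]) hβ w hF'
  simp only [hfg] at h
  rw [tsum_eq_sum (f := fun n : ℤ => (f (n / β) : ℂ) * _) (s := Finset.Icc (-3 : ℤ) 3)] at h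
  · rw [← Complex.ofReal_tsum] at h
    have h2 := congrArg Complex.re h
    rw [← Complex.ofReal_mul, Complex.ofReal_re, Complex.re_sum] at h2
    rw [h2, samplePoly]
    refine Finset.sum_congr rfl fun n _ => ?_
    rw [show -2 * Real.pi * ((n : ℝ) / β) * w = -(n * (2 * Real.pi * w / β)) by ring,
      show (n : ℝ) * (1 / β) = n / β by ring, Complex.re_ofReal_mul,
      Complex.exp_ofReal_mul_I_re, Real.cos_neg]
  · intro n hn
    have hn4 : 4 ≤ |n| := by
      rw [Finset.mem_Icc, ← abs_le] at hn
      omega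
    have hn4' : (4 : ℝ) ≤ |(n : ℝ)| := by exact_mod_cast hn4
    rw [hs, Complex.ofReal_zero, zero_mul]
    rw [abs_div, abs_of_pos hβ, le_div_iff₀ hβ]
    linarith

/-! ### The two series of the Bernstein ratio -/

theorem fourier_bsplineWindow_two (w : ℝ) :
    𝓕 (bsplineWindow 2) w = ((Real.sinc (Real.pi * w)) ^ 2 : ℝ) := fourier_bspline_two w

theorem bernsteinDenTerm_bsplineWindow_two (β w : ℝ) (l : ℤ) :
    bernsteinDenTerm (bsplineWindow 2) (1 / β) w l = Real.sinc (Real.pi * (w + l * β)) ^ 4 := by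
  rw [bernsteinDenTerm, fourier_bsplineWindow_two, Complex.norm_real, Real.norm_eq_abs, sq_abs,
    div_div_eq_mul_div, div_one]
  ring

theorem bernsteinNumTerm_bsplineWindow_two (β w : ℝ) (l : ℤ) :
    bernsteinNumTerm (bsplineWindow 2) (1 / β) w l
      = (w + l * β) ^ 2 * Real.sinc (Real.pi * (w + l * β)) ^ 4 := by
  rw [bernsteinNumTerm, fourier_bsplineWindow_two, Complex.norm_real, Real.norm_eq_abs, sq_abs,
    div_div_eq_mul_div, div_one]
  ring

theorem sq_mul_sinc_pow_four_le (v : ℝ) :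
    v ^ 2 * Real.sinc (Real.pi * v) ^ 4 ≤ 2 * (1 / (1 + v ^ 2)) := by
  have hpi := Real.pi_gt_three
  have h1 : Real.sinc (Real.pi * v) ^ 2 ≤ 1 := by
    rw [← sq_abs]; exact pow_le_one₀ (abs_nonneg _) (Real.abs_sinc_le_one _)
  have h2 : v ^ 2 * Real.sinc (Real.pi * v) ^ 2 ≤ 1 := by
    have hs := mul_sinc (Real.pi * v)
    have : Real.pi ^ 2 * (v ^ 2 * Real.sinc (Real.pi * v) ^ 2) = Real.sin (Real.pi * v) ^ 2 := by
      rw [← hs]; ring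
    nlinarith [Real.sin_sq_le_one (Real.pi * v),
      mul_nonneg (sq_nonneg v) (sq_nonneg (Real.sinc (Real.pi * v)))]
  rw [mul_one_div, le_div_iff₀ (by positivity)]
  set S := Real.sinc (Real.pi * v) ^ 2
  have hS : 0 ≤ S := sq_nonneg _
  have e : v ^ 2 * Real.sinc (Real.pi * v) ^ 4 * (1 + v ^ 2)
      = (v ^ 2 * S) * S + (v ^ 2 * S) * (v ^ 2 * S) := by simp only [S]; ring
  rw [e]
  have h3 : 0 ≤ v ^ 2 * S := by positivity
  nlinarith [mul_le_mul h2 h1 hS zero_le_one, mul_le_mul h2 h2 h3 zero_le_one]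

theorem sinc_pow_four_le (v : ℝ) :
    Real.sinc (Real.pi * v) ^ 4 ≤ 3 * (1 / (1 + v ^ 2)) := by
  have h := sq_mul_sinc_pow_four_le v
  have h1 : Real.sinc (Real.pi * v) ^ 4 ≤ 1 := by
    rw [← Even.pow_abs (by decide : Even 4)]
    exact pow_le_one₀ (abs_nonneg _) (Real.abs_sinc_le_one _)
  rw [mul_one_div, le_div_iff₀ (by positivity)] at h ⊢
  rcases le_total (v ^ 2) 1 with hv | hv
  · nlinarith [pow_nonneg (sq_nonneg (Real.sinc (Real.pi * v))) 2, sq_nonneg v]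
  · have h4 : 0 ≤ Real.sinc (Real.pi * v) ^ 4 := by positivity
    nlinarith [mul_nonneg h4 (sub_nonneg.2 hv)]

theorem summable_sq_mul_sinc_pow_four {β : ℝ} (hβ : 0 < β) (w : ℝ) :
    Summable fun l : ℤ => (w + l * β) ^ 2 * Real.sinc (Real.pi * (w + l * β)) ^ 4 :=
  Summable.of_nonneg_of_le (fun l => by positivity) (fun l => sq_mul_sinc_pow_four_le _)
    ((summable_inv_one_add_sq_shift hβ w).mul_left 2)

theorem summable_sinc_pow_four {β : ℝ} (hβ : 0 < β) (w : ℝ) :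
    Summable fun l : ℤ => Real.sinc (Real.pi * (w + l * β)) ^ 4 :=
  Summable.of_nonneg_of_le (fun l => by positivity) (fun l => sinc_pow_four_le _)
    ((summable_inv_one_add_sq_shift hβ w).mul_left 3)

theorem tsum_sinc_pow_four_eq {β : ℝ} (hβ : 0 < β) (hβ2 : β < 2) (w : ℝ) :
    β * ∑' l : ℤ, Real.sinc (Real.pi * (w + l * β)) ^ 4
      = samplePoly (bspline 4) (1 / β) (2 * Real.pi * w / β) :=
  tsum_fourier_eq_samplePoly (g := fun v => Real.sinc (Real.pi * v) ^ 4) continuous_bspline_four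
    (fun _ => bspline_four_eq_zero) fourier_bspline_four hβ hβ2 w (summable_sinc_pow_four hβ w)

theorem tsum_sq_mul_sinc_pow_four_eq {β : ℝ} (hβ : 0 < β) (hβ2 : β < 2) (w : ℝ) :
    4 * Real.pi ^ 2 * (β * ∑' l : ℤ, (w + l * β) ^ 2 * Real.sinc (Real.pi * (w + l * β)) ^ 4)
      = samplePoly negSecondDiff (1 / β) (2 * Real.pi * w / β) := by
  rw [← tsum_fourier_eq_samplePoly
    (g := fun v => 4 * Real.pi ^ 2 * (v ^ 2 * Real.sinc (Real.pi * v) ^ 4))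
    continuous_negSecondDiff (fun _ => negSecondDiff_eq_zero) fourier_negSecondDiff hβ hβ2 w
    ((summable_sq_mul_sinc_pow_four hβ w).mul_left _), tsum_mul_left]
  ring

/-- The zeros of `sinc (π ·)` are the nonzero integers; a translate of `β ℤ` contained in this set
would force `β` to be an integer, hence `β = 1`, but then it would contain `0`. -/
theorem tsum_sinc_pow_four_pos {β : ℝ} (hβ : 0 < β) (hβ2 : β < 2) (w : ℝ) :
    0 < ∑' l : ℤ, Real.sinc (Real.pi * (w + l * β)) ^ 4 := by
  have hex : ∃ l : ℤ, Real.sinc (Real.pi * (w + l * β)) ≠ 0 := by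
    by_contra! h
    have hint (l : ℤ) : ∃ n : ℤ, (n : ℝ) = w + l * β := by
      have h1 : Real.sin (Real.pi * (w + l * β)) = 0 := by rw [← mul_sinc, h l, mul_zero]
      obtain ⟨n, hn⟩ := Real.sin_eq_zero_iff.1 h1
      refine ⟨n, ?_⟩
      have := Real.pi_pos.ne'
      field_simp at hn
      linarith
    obtain ⟨n0, hn0⟩ := hint 0
    obtain ⟨n1, hn1⟩ := hint 1
    push_cast at hn0 hn1
    have hb : ((n1 - n0 : ℤ) : ℝ) = β := by push_cast; linarith
    have hb1 : n1 - n0 = 1 := by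
      have h1 : (0 : ℝ) < ((n1 - n0 : ℤ) : ℝ) := by rw [hb]; exact hβ
      have h2 : ((n1 - n0 : ℤ) : ℝ) < (2 : ℤ) := by rw [hb]; exact_mod_cast hβ2
      have h1' : 0 < n1 - n0 := by exact_mod_cast h1
      have h2' : n1 - n0 < 2 := by exact_mod_cast h2
      omega
    rw [hb1] at hb
    have := h (-n0)
    rw [← hb, show w + ((-n0 : ℤ) : ℝ) * ((1 : ℤ) : ℝ) = 0 by push_cast; linarith] at this
    simp at this
  obtain ⟨l, hl⟩ := hex
  exact (summable_sinc_pow_four hβ w).tsum_pos (fun l => by positivity) l (by positivity)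

theorem samplePoly_bspline_four_pos {β : ℝ} (hβ : 0 < β) (hβ2 : β < 2) (θ : ℝ) :
    0 < samplePoly (bspline 4) (1 / β) θ := by
  have h := tsum_sinc_pow_four_eq hβ hβ2 (θ * β / (2 * Real.pi))
  rw [show 2 * Real.pi * (θ * β / (2 * Real.pi)) / β = θ by
    have := Real.pi_pos.ne'
    field_simp] at h
  rw [← h]
  exact mul_pos hβ (tsum_sinc_pow_four_pos hβ hβ2 _)

theorem bernsteinRatio_eq {β : ℝ} (hβ : 0 < β) (hβ2 : β < 2) (w : ℝ) :
    bernsteinRatio (bsplineWindow 2) (1 / β) w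
      = 1 / (4 * Real.pi ^ 2) * (samplePoly negSecondDiff (1 / β) (2 * Real.pi * w / β)
        / samplePoly (bspline 4) (1 / β) (2 * Real.pi * w / β)) := by
  unfold bernsteinRatio
  simp_rw [bernsteinNumTerm_bsplineWindow_two, bernsteinDenTerm_bsplineWindow_two]
  rw [← tsum_sinc_pow_four_eq hβ hβ2, ← tsum_sq_mul_sinc_pow_four_eq hβ hβ2]
  have h1 := (tsum_sinc_pow_four_pos hβ hβ2 w).ne'
  have h2 := Real.pi_pos.ne'
  have h3 := hβ.ne'
  generalize (∑' l : ℤ, Real.sinc (Real.pi * (w + l * β)) ^ 4) = X at *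
  generalize (∑' l : ℤ, (w + l * β) ^ 2 * Real.sinc (Real.pi * (w + l * β)) ^ 4) = Y at *
  field_simp

/-! ### The location of the maximum -/

theorem negSecondDiff_of_nonneg_of_le_one {x : ℝ} (h0 : 0 ≤ x) (h1 : x ≤ 1) :
    negSecondDiff x = 2 - 3 * x := by
  rw [negSecondDiff, bspline_two_eq_zero (x := x + 1) (by rw [abs_of_nonneg] <;> linarith),
    bspline_two, bspline_two, abs_of_nonneg h0, abs_of_nonpos (by linarith : x - 1 ≤ 0),
    max_eq_right (by linarith), max_eq_right (by linarith)]
  ring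

theorem negSecondDiff_of_one_le_of_le_two {x : ℝ} (h0 : 1 ≤ x) (h1 : x ≤ 2) :
    negSecondDiff x = -(2 - x) := by
  rw [negSecondDiff, bspline_two_eq_zero (x := x + 1) (by rw [abs_of_nonneg] <;> linarith),
    bspline_two_eq_zero (x := x) (by rw [abs_of_nonneg] <;> linarith),
    bspline_two, abs_of_nonneg (by linarith : 0 ≤ x - 1), max_eq_right (by linarith)]
  ring

theorem negSecondDiff_of_two_le {x : ℝ} (h0 : 2 ≤ x) : negSecondDiff x = 0 :=
  negSecondDiff_eq_zero (by rwa [abs_of_nonneg (by linarith)])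

theorem samplePoly_eq_cubic {a : ℝ → ℝ} (ha : ∀ x, a (-x) = a x) (s θ : ℝ) :
    samplePoly a s θ = a 0 + 2 * (a s * Real.cos θ + a (2 * s) * (2 * Real.cos θ ^ 2 - 1)
      + a (3 * s) * (4 * Real.cos θ ^ 3 - 3 * Real.cos θ)) := by
  rw [samplePoly_eq ha, Real.cos_two_mul, Real.cos_three_mul]

/-- The increment of `samplePoly a s` from its value at `π` is divisible by `1 + cos θ`. -/
theorem samplePoly_sub_samplePoly_pi {a : ℝ → ℝ} (ha : ∀ x, a (-x) = a x) (s θ : ℝ) :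
    samplePoly a s θ - samplePoly a s Real.pi = 2 * (1 + Real.cos θ) * (a s
      + 2 * a (2 * s) * (Real.cos θ - 1) + a (3 * s) * (2 * Real.cos θ - 1) ^ 2) := by
  rw [samplePoly_eq_cubic ha, samplePoly_eq_cubic ha, Real.cos_pi]; ring

theorem samplePoly_pi {a : ℝ → ℝ} (ha : ∀ x, a (-x) = a x) (s : ℝ) :
    samplePoly a s Real.pi = a 0 + 2 * (-a s + a (2 * s) - a (3 * s)) := by
  rw [samplePoly_eq_cubic ha, Real.cos_pi]; ring

theorem bspline_four_zero : bspline 4 0 = 2 / 3 := by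
  rw [bspline_four_of_nonneg_of_le_one le_rfl zero_le_one]; norm_num

theorem negSecondDiff_zero : negSecondDiff 0 = 2 := by
  rw [negSecondDiff_of_nonneg_of_le_one le_rfl zero_le_one]; norm_num

/-- The comparison for `2 / 3 ≤ 1 / β ≤ 1`, where both sides are affine in `y = cos θ`, so that it
reduces to `y = 1` and `y = -1`. -/
theorem quotient_comparison_affine {s y : ℝ} (h3 : 2 / 3 ≤ s) (h1 : s ≤ 1) (hy0 : -1 ≤ y)
    (hy1 : y ≤ 1) :
    (2 - 3 * s + 2 * -(2 - 2 * s) * (y - 1) + 0 * (2 * y - 1) ^ 2)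
        * ((6 - 24 * s + 30 * s ^ 2 - 11 * s ^ 3) / 3)
      ≤ (10 * s - 6) * ((4 - 6 * s ^ 2 + 3 * s ^ 3) / 6 + 2 * ((2 - 2 * s) ^ 3 / 6) * (y - 1)
        + 0 * (2 * y - 1) ^ 2) := by
  have hb : 0 ≤ 10 * s - 6 := by linarith
  have hc : 0 ≤ 3 * s - 2 := by linarith
  have ha : 0 ≤ 6 - 24 * s + 30 * s ^ 2 - 11 * s ^ 3 := by
    obtain ⟨r, rfl⟩ : ∃ r, s = 2 / 3 + r := ⟨s - 2 / 3, by ring⟩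
    have hr0 : 0 ≤ r := by linarith
    have hr1 : r ≤ 1 / 3 := by linarith
    nlinarith [mul_nonneg hr0 (sub_nonneg.2 hr1), mul_nonneg (mul_nonneg hr0 hr0)
      (sub_nonneg.2 hr1)]
  have ha1' : 0 ≤ 4 - 6 * s ^ 2 + 3 * s ^ 3 := by
    nlinarith [sq_nonneg (s - 1), mul_nonneg hc (sq_nonneg (s - 1))]
  have hq : 0 ≤ (2 * s - 1) * (54 * s ^ 3 - 148 * s ^ 2 + 148 * s - 48) := by
    refine mul_nonneg (by linarith) ?_
    have : 0 ≤ 54 * s ^ 2 - 112 * s + 73 := by nlinarith [sq_nonneg (s - 28 / 27)]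
    nlinarith [mul_nonneg hc this]
  have p1 : 0 ≤ (1 + y) / 2 * ((10 * s - 6) * (4 - 6 * s ^ 2 + 3 * s ^ 3) / 6
      + (6 - 24 * s + 30 * s ^ 2 - 11 * s ^ 3) / 3 * (3 * s - 2)) := by
    have : 0 ≤ (1 + y) / 2 := by linarith
    positivity
  have p2 : 0 ≤ (1 - y) / 2 *
      ((2 * s - 1) * (54 * s ^ 3 - 148 * s ^ 2 + 148 * s - 48) / 6) :=
    mul_nonneg (by linarith) (by linarith)
  rw [← sub_nonneg]
  refine (add_nonneg p1 p2).trans_eq ?_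
  ring

/-- The comparison for `1 / 2 < 1 / β ≤ 2 / 3`, in the variables `t = 2 / β - 1` and
`v = 1 + cos θ`. -/
theorem quotient_comparison_quadratic {t v : ℝ} (ht0 : 0 < t) (ht1 : 3 * t ≤ 1) (hv0 : 0 ≤ v) :
    (2 - 3 * ((1 + t) / 2) + 2 * -(2 - 2 * ((1 + t) / 2)) * (v - 1 - 1)
        + -(2 - 3 * ((1 + t) / 2)) * (2 * (v - 1) - 1) ^ 2) * (2 / 3 * t ^ 3)
      ≤ 2 * t * ((4 - 6 * ((1 + t) / 2) ^ 2 + 3 * ((1 + t) / 2) ^ 3) / 6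
        + 2 * ((2 - 2 * ((1 + t) / 2)) ^ 3 / 6) * (v - 1 - 1)
        + (2 - 3 * ((1 + t) / 2)) ^ 3 / 6 * (2 * (v - 1) - 1) ^ 2) := by
  have key : 0 ≤ 6 * t ^ 2 * (3 - 7 * t)
      + v * (1 / 2 + t * (15 / 2 - 85 / 2 * t + 141 / 2 * t ^ 2))
      + v ^ 2 * ((1 - 3 * t) * (1 / 2 - 3 * t + 17 / 2 * t ^ 2)) := by
    have k1 : 0 ≤ 3 - 7 * t := by linarith
    have k2 : 0 ≤ 15 / 2 - 85 / 2 * t + 141 / 2 * t ^ 2 := by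
      nlinarith [sq_nonneg (t - 85 / 282)]
    have k3 : 0 ≤ 1 / 2 - 3 * t + 17 / 2 * t ^ 2 := by nlinarith [sq_nonneg (t - 3 / 17)]
    have k4 : 0 ≤ 1 - 3 * t := by linarith
    positivity
  have := mul_nonneg (by linarith : 0 ≤ t / 3) key
  rw [← sub_nonneg]
  refine this.trans_eq ?_
  ring

/-- The quotient of the two trigonometric polynomials is largest at `θ = π`. After division by
`1 + cos θ`, what remains is a polynomial inequality in `cos θ` and `1 / β`. -/
theorem samplePoly_mul_le {s : ℝ} (hs : 1 / 2 < s) (θ : ℝ) :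
    samplePoly negSecondDiff s θ * samplePoly (bspline 4) s Real.pi
      ≤ samplePoly negSecondDiff s Real.pi * samplePoly (bspline 4) s θ := by
  have hA := samplePoly_sub_samplePoly_pi bspline_four_neg s θ
  have hB := samplePoly_sub_samplePoly_pi negSecondDiff_neg s θ
  have hApi := samplePoly_pi bspline_four_neg s
  have hBpi := samplePoly_pi negSecondDiff_neg s
  rw [bspline_four_zero] at hApi
  rw [negSecondDiff_zero] at hBpi
  have hy1 := Real.cos_le_one θ
  have hy0 := Real.neg_one_le_cos θ
  set y := Real.cos θ
  suffices h : (negSecondDiff s + 2 * negSecondDiff (2 * s) * (y - 1)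
      + negSecondDiff (3 * s) * (2 * y - 1) ^ 2) * samplePoly (bspline 4) s Real.pi
      ≤ samplePoly negSecondDiff s Real.pi * (bspline 4 s + 2 * bspline 4 (2 * s) * (y - 1)
      + bspline 4 (3 * s) * (2 * y - 1) ^ 2) by
    have h2 := mul_le_mul_of_nonneg_left h (by linarith : 0 ≤ 2 * (1 + y))
    rw [← sub_nonneg] at h2 ⊢
    refine h2.trans_eq ?_
    rw [eq_add_of_sub_eq hA, eq_add_of_sub_eq hB]
    ring
  rcases le_total 2 s with h2 | h2
  · rw [negSecondDiff_of_two_le h2, negSecondDiff_of_two_le (by linarith : 2 ≤ 2 * s),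
      negSecondDiff_of_two_le (by linarith : 2 ≤ 3 * s), bspline_four_of_two_le h2,
      bspline_four_of_two_le (by linarith : 2 ≤ 2 * s),
      bspline_four_of_two_le (by linarith : 2 ≤ 3 * s)]
    simp
  rcases le_total 1 s with h1 | h1
  · rw [negSecondDiff_of_two_le (by linarith : 2 ≤ 2 * s),
      negSecondDiff_of_two_le (by linarith : 2 ≤ 3 * s),
      bspline_four_of_two_le (by linarith : 2 ≤ 2 * s),
      bspline_four_of_two_le (by linarith : 2 ≤ 3 * s),
      negSecondDiff_of_one_le_of_le_two h1 h2, bspline_four_of_one_le_of_le_two h1 h2] at *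
    have hd : 0 ≤ 2 - s := by linarith
    have hd1 : (2 - s) ^ 3 ≤ 1 := pow_le_one₀ hd (by linarith)
    have hA0 : 0 ≤ samplePoly (bspline 4) s Real.pi := by rw [hApi]; linarith
    have hB0 : 0 ≤ samplePoly negSecondDiff s Real.pi := by rw [hBpi]; linarith
    have := mul_nonneg hB0 (pow_nonneg hd 3)
    nlinarith [mul_nonneg hd hA0]
  have ha1 := bspline_four_of_nonneg_of_le_one (by linarith : 0 ≤ s) h1
  have hb1 := negSecondDiff_of_nonneg_of_le_one (by linarith : 0 ≤ s) h1
  have ha2 := bspline_four_of_one_le_of_le_two (by linarith : 1 ≤ 2 * s) (by linarith)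
  have hb2 := negSecondDiff_of_one_le_of_le_two (by linarith : 1 ≤ 2 * s) (by linarith)
  rcases le_total (2 / 3) s with h3 | h3
  · have ha3 := bspline_four_of_two_le (by linarith : 2 ≤ 3 * s)
    have hb3 := negSecondDiff_of_two_le (by linarith : 2 ≤ 3 * s)
    rw [ha1, ha2, ha3] at hApi
    rw [hb1, hb2, hb3] at hBpi
    rw [ha1, ha2, ha3, hb1, hb2, hb3]
    have eA : samplePoly (bspline 4) s Real.pi
        = (6 - 24 * s + 30 * s ^ 2 - 11 * s ^ 3) / 3 := by rw [hApi]; ring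
    have eB : samplePoly negSecondDiff s Real.pi = 10 * s - 6 := by rw [hBpi]; ring
    rw [eA, eB]
    exact quotient_comparison_affine h3 h1 hy0 hy1
  · -- Both values at `π` are multiples of `2 s - 1`, which vanishes in the limit `β → 2`.
    have ha3 := bspline_four_of_one_le_of_le_two (by linarith : 1 ≤ 3 * s) (by linarith)
    have hb3 := negSecondDiff_of_one_le_of_le_two (by linarith : 1 ≤ 3 * s) (by linarith)
    rw [ha1, ha2, ha3] at hApi
    rw [hb1, hb2, hb3] at hBpi
    rw [ha1, ha2, ha3, hb1, hb2, hb3]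
    obtain ⟨t, rfl⟩ : ∃ t, s = (1 + t) / 2 := ⟨2 * s - 1, by ring⟩
    obtain ⟨v, hv⟩ : ∃ v, v = 1 + y := ⟨_, rfl⟩
    have hyv : y = v - 1 := by rw [hv]; ring
    have eA : samplePoly (bspline 4) ((1 + t) / 2) Real.pi = 2 / 3 * t ^ 3 := by rw [hApi]; ring
    have eB : samplePoly negSecondDiff ((1 + t) / 2) Real.pi = 2 * t := by rw [hBpi]; ring
    rw [eA, eB, hyv]
    exact quotient_comparison_quadratic (by linarith) (by linarith) (by linarith)

theorem continuous_samplePoly (a : ℝ → ℝ) (s : ℝ) : Continuous (samplePoly a s) := by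
  unfold samplePoly; fun_prop

theorem half_lt_one_div {β : ℝ} (hβ : 0 < β) (hβ2 : β < 2) : 1 / 2 < 1 / β :=
  one_div_lt_one_div_of_lt hβ hβ2

theorem bernsteinRatio_half {β : ℝ} (hβ : 0 < β) (hβ2 : β < 2) :
    bernsteinRatio (bsplineWindow 2) (1 / β) (β / 2)
      = 1 / (4 * Real.pi ^ 2) * (samplePoly negSecondDiff (1 / β) Real.pi
        / samplePoly (bspline 4) (1 / β) Real.pi) := by
  rw [bernsteinRatio_eq hβ hβ2, show 2 * Real.pi * (β / 2) / β = Real.pi by field_simp]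

theorem bernsteinRatio_le {β : ℝ} (hβ : 0 < β) (hβ2 : β < 2) (w : ℝ) :
    bernsteinRatio (bsplineWindow 2) (1 / β) w
      ≤ bernsteinRatio (bsplineWindow 2) (1 / β) (β / 2) := by
  rw [bernsteinRatio_half hβ hβ2, bernsteinRatio_eq hβ hβ2]
  refine mul_le_mul_of_nonneg_left ?_ (by positivity)
  rw [div_le_div_iff₀ (samplePoly_bspline_four_pos hβ hβ2 _)
    (samplePoly_bspline_four_pos hβ hβ2 _)]
  exact samplePoly_mul_le (half_lt_one_div hβ hβ2) _

theorem continuous_bernsteinRatio {β : ℝ} (hβ : 0 < β) (hβ2 : β < 2) :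
    Continuous (bernsteinRatio (bsplineWindow 2) (1 / β)) := by
  rw [funext (bernsteinRatio_eq hβ hβ2)]
  have h1 := continuous_samplePoly negSecondDiff (1 / β)
  have h2 := continuous_samplePoly (bspline 4) (1 / β)
  refine continuous_const.mul (Continuous.div (by fun_prop) (by fun_prop) fun w => ?_)
  exact (samplePoly_bspline_four_pos hβ hβ2 _).ne'

/-- The essential supremum of a continuous function over an interval is a maximum that is attained
in the interior. -/
theorem essSup_restrict_Icc_eq_of_isMax {f : ℝ → ℝ} (hf : Continuous f) {a b x : ℝ}
    (hx : x ∈ Ioo a b) (hmax : ∀ y, f y ≤ f x) :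
    essSup f (volume.restrict (Icc a b)) = f x := by
  set μ := volume.restrict (Icc a b) with hμ
  have hμU {U : Set ℝ} (hU : IsOpen U) (hxU : x ∈ U) : μ U ≠ 0 := by
    have h1 : 0 < volume (U ∩ Ioo a b) := (hU.inter isOpen_Ioo).measure_pos _ ⟨x, hxU, hx⟩
    rw [hμ, Measure.restrict_apply hU.measurableSet]
    exact (h1.trans_le (measure_mono (inter_subset_inter_right _ Ioo_subset_Icc_self))).ne'
  have hne : (ae μ).NeBot := by
    rw [ae_neBot]
    intro h
    exact hμU isOpen_univ (mem_univ x) (by rw [h]; rfl)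
  have hbdd : Filter.IsBoundedUnder (· ≤ ·) (ae μ) f :=
    Filter.isBoundedUnder_of ⟨f x, hmax⟩
  -- A lower bound valid on a set of positive measure makes the essential supremum meaningful.
  have hfreq {c : ℝ} (hc : c < f x) : ∃ᵐ y ∂μ, c < f y := by
    intro h
    refine hμU (isOpen_lt continuous_const hf) hc ?_
    simpa [ae_iff] using h
  have hcob : Filter.IsCoboundedUnder (· ≤ ·) (ae μ) f :=
    Filter.IsCoboundedUnder.of_frequently_ge
      ((hfreq (sub_one_lt (f x))).mono fun y hy => hy.le)
  refine le_antisymm (essSup_le_of_ae_le _ (Filter.Eventually.of_forall hmax) hcob) ?_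
  by_contra! hlt
  obtain ⟨c, hc1, hc2⟩ := exists_between hlt
  refine hfreq hc2 ?_
  filter_upwards [ae_lt_of_essSup_lt hc1 hbdd] with y hy
  exact hy.le.not_gt

theorem bernsteinConst_eq {β : ℝ} (hβ : 0 < β) (hβ2 : β < 2) :
    bernsteinConst (bsplineWindow 2) (1 / β)
      = bernsteinRatio (bsplineWindow 2) (1 / β) (β / 2) := by
  unfold bernsteinConst
  rw [one_div_one_div]
  exact essSup_restrict_Icc_eq_of_isMax (continuous_bernsteinRatio hβ hβ2)
    ⟨by linarith, by linarith⟩ (bernsteinRatio_le hβ hβ2)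

theorem bernsteinConst_formula {β : ℝ} (hβ : 0 < β) (hβ2 : β < 2) :
    bernsteinConst (bsplineWindow 2) (1 / β) =
      1 / (4 * Real.pi ^ 2) *
        ((1 - 2 * bspline 2 (1 / β) + bspline 2 (1 - 1 / β) - bspline 2 (1 - 2 / β)
            + bspline 2 (1 - 3 / β)) /
          (1 / 3 - bspline 4 (1 / β) + bspline 4 (2 / β) - bspline 4 (3 / β))) := by
  have hs := half_lt_one_div hβ hβ2
  rw [bernsteinConst_eq hβ hβ2, bernsteinRatio_half hβ hβ2, samplePoly_pi negSecondDiff_neg,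
    samplePoly_pi bspline_four_neg, bspline_four_zero, negSecondDiff_zero,
    show 2 / β = 2 * (1 / β) by ring, show 3 / β = 3 * (1 / β) by ring]
  generalize 1 / β = s at *
  have hz {x : ℝ} (hx : 1 ≤ x) : bspline 2 x = 0 :=
    bspline_two_eq_zero (hx.trans (le_abs_self x))
  have hr (x : ℝ) : bspline 2 (1 - x) = bspline 2 (x - 1) := by
    rw [← bspline_two_neg, neg_sub]
  simp only [negSecondDiff, hr]
  rw [hz (x := 2 * s) (by linarith), hz (x := 3 * s) (by linarith), hz (x := s + 1) (by linarith),
    hz (x := 2 * s + 1) (by linarith), hz (x := 3 * s + 1) (by linarith)]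
  congr 1
  rw [← mul_div_mul_left _ (1 / 3 - _ + _ - _) (two_ne_zero (α := ℝ))]
  congr 1 <;> ring

/-- The pointwise Bernstein inequality between the two trigonometric polynomials. -/
theorem samplePoly_negSecondDiff_le {β : ℝ} (hβ : 0 < β) (hβ2 : β < 2) (θ : ℝ) :
    samplePoly negSecondDiff (1 / β) θ
      ≤ 4 * Real.pi ^ 2 * bernsteinConst (bsplineWindow 2) (1 / β)
        * samplePoly (bspline 4) (1 / β) θ := by
  have h := samplePoly_mul_le (half_lt_one_div hβ hβ2) θ
  have hp := samplePoly_bspline_four_pos hβ hβ2 Real.pi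
  have hpi := Real.pi_pos.ne'
  rw [bernsteinConst_eq hβ hβ2, bernsteinRatio_half hβ hβ2, ← mul_assoc,
    mul_one_div_cancel (by positivity), one_mul, div_mul_eq_mul_div, le_div_iff₀ hp]
  exact h

theorem exists_le_samplePoly_bspline_four {β : ℝ} (hβ : 0 < β) (hβ2 : β < 2) :
    ∃ κ : ℝ, 0 < κ ∧ ∀ θ, κ ≤ samplePoly (bspline 4) (1 / β) θ := by
  have hcont := continuous_samplePoly (bspline 4) (1 / β)
  have hper (θ : ℝ) : ∃ t ∈ Icc 0 (2 * Real.pi),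
      samplePoly (bspline 4) (1 / β) t = samplePoly (bspline 4) (1 / β) θ := by
    have hP : Function.Periodic (samplePoly (bspline 4) (1 / β)) (2 * Real.pi) := by
      intro x
      unfold samplePoly
      refine Finset.sum_congr rfl fun n _ => ?_
      rw [mul_add, Real.cos_add_int_mul_two_pi]
    obtain ⟨t, ht, h⟩ := hP.exists_mem_Ico₀ Real.two_pi_pos θ
    exact ⟨t, Ico_subset_Icc_self ht, h.symm⟩
  obtain ⟨t₀, -, h₀⟩ := (isCompact_Icc (a := 0) (b := 2 * Real.pi)).exists_isMinOn
    (nonempty_Icc.2 Real.two_pi_pos.le) hcont.continuousOn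
  refine ⟨_, samplePoly_bspline_four_pos hβ hβ2 t₀, fun θ => ?_⟩
  obtain ⟨t, ht, h⟩ := hper θ
  rw [← h]
  exact h₀ ht

/-! ### Positivity of Toeplitz forms with nonnegative symbol -/

theorem integral_cos_int_mul (m : ℤ) :
    ∫ θ in (0 : ℝ)..(2 * Real.pi), Real.cos (m * θ) = if m = 0 then 2 * Real.pi else 0 := by
  split_ifs with h
  · simp [h]
  · have hm : (m : ℝ) ≠ 0 := by exact_mod_cast h
    rw [intervalIntegral.integral_comp_mul_left _ hm, integral_cos]
    have := Real.sin_int_mul_pi (2 * m)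
    push_cast at this
    rw [show (m : ℝ) * (2 * Real.pi) = 2 * m * Real.pi by ring, this]
    simp

theorem integral_cos_mul_cos_int (n m : ℤ) :
    ∫ θ in (0 : ℝ)..(2 * Real.pi), Real.cos (n * θ) * Real.cos (m * θ)
      = (if n = m then Real.pi else 0) + (if n = -m then Real.pi else 0) := by
  have e : (fun θ : ℝ => Real.cos (n * θ) * Real.cos (m * θ)) = fun θ : ℝ =>
      (Real.cos ((n - m : ℤ) * θ) + Real.cos ((n + m : ℤ) * θ)) / 2 := by
    ext θ
    push_cast
    rw [sub_mul, add_mul, Real.cos_sub, Real.cos_add]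
    ring
  rw [e, intervalIntegral.integral_div, intervalIntegral.integral_add
    (Continuous.intervalIntegrable (by fun_prop) _ _)
    (Continuous.intervalIntegrable (by fun_prop) _ _), integral_cos_int_mul, integral_cos_int_mul]
  simp only [sub_eq_zero, eq_neg_iff_add_eq_zero]
  split_ifs <;> ring

/-- The samples `a (m s)` are the Fourier coefficients of `samplePoly a s`. -/
theorem integral_samplePoly_mul_cos {a : ℝ → ℝ} (ha : ∀ x, a (-x) = a x)
    (ha2 : ∀ x, 2 ≤ |x| → a x = 0) {s : ℝ} (hs : 1 / 2 < s) (m : ℤ) :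
    ∫ θ in (0 : ℝ)..(2 * Real.pi), samplePoly a s θ * Real.cos (m * θ)
      = 2 * Real.pi * a (m * s) := by
  simp only [samplePoly, Finset.sum_mul]
  rw [intervalIntegral.integral_finsetSum
    (fun n _ => Continuous.intervalIntegrable (by fun_prop) _ _)]
  simp only [mul_assoc, intervalIntegral.integral_const_mul, integral_cos_mul_cos_int, mul_add,
    Finset.sum_add_distrib, mul_ite, mul_zero, Finset.sum_ite_eq']
  have hneg : a ((-m : ℤ) * s) = a (m * s) := by rw [Int.cast_neg, neg_mul, ha]
  rw [hneg]
  by_cases hm : m ∈ Finset.Icc (-3 : ℤ) 3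
  · have hm' : -m ∈ Finset.Icc (-3 : ℤ) 3 := by
      rw [Finset.mem_Icc] at hm ⊢; omega
    rw [if_pos hm, if_pos hm']; ring
  · have hm' : -m ∉ Finset.Icc (-3 : ℤ) 3 := by
      rw [Finset.mem_Icc] at hm ⊢; omega
    have hm4 : 4 ≤ |m| := by
      rw [Finset.mem_Icc, ← abs_le] at hm; omega
    have hm4' : (4 : ℝ) ≤ |(m : ℝ)| := by exact_mod_cast hm4
    rw [if_neg hm, if_neg hm', ha2 (m * s)]
    · ring
    · rw [abs_mul, abs_of_pos (by linarith : 0 < s)]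
      nlinarith

/-- Up to a factor `2 π`, the form is the integral over a period of
`samplePoly a s θ * |∑ c_l e^{i l θ}|²`. -/
theorem toeplitz_form_nonneg {a : ℝ → ℝ} (ha : ∀ x, a (-x) = a x)
    (ha2 : ∀ x, 2 ≤ |x| → a x = 0) {s : ℝ} (hs : 1 / 2 < s)
    (hpos : ∀ θ, 0 ≤ samplePoly a s θ) (S : Finset ℤ) (c : ℤ → ℝ) :
    0 ≤ ∑ l ∈ S, ∑ m ∈ S, c l * c m * a (l * s - m * s) := by
  have hc := continuous_samplePoly a s
  have e : 2 * Real.pi * ∑ l ∈ S, ∑ m ∈ S, c l * c m * a (l * s - m * s)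
      = ∫ θ in (0 : ℝ)..(2 * Real.pi), samplePoly a s θ *
        ((∑ l ∈ S, c l * Real.cos (l * θ)) ^ 2 + (∑ l ∈ S, c l * Real.sin (l * θ)) ^ 2) := by
    have e1 (θ : ℝ) : samplePoly a s θ *
        ((∑ l ∈ S, c l * Real.cos (l * θ)) ^ 2 + (∑ l ∈ S, c l * Real.sin (l * θ)) ^ 2)
        = ∑ l ∈ S, ∑ m ∈ S, c l * c m *
          (samplePoly a s θ * Real.cos ((l - m : ℤ) * θ)) := by
      rw [sq, sq, Finset.sum_mul_sum, Finset.sum_mul_sum, ← Finset.sum_add_distrib,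
        Finset.mul_sum]
      refine Finset.sum_congr rfl fun l _ => ?_
      rw [← Finset.sum_add_distrib, Finset.mul_sum]
      refine Finset.sum_congr rfl fun m _ => ?_
      push_cast
      rw [sub_mul, Real.cos_sub]
      ring
    simp only [e1]
    rw [intervalIntegral.integral_finsetSum
      (fun l _ => Continuous.intervalIntegrable (by fun_prop) _ _), Finset.mul_sum]
    refine Finset.sum_congr rfl fun l _ => ?_
    rw [intervalIntegral.integral_finsetSum
      (fun l _ => Continuous.intervalIntegrable (by fun_prop) _ _), Finset.mul_sum]
    refine Finset.sum_congr rfl fun m _ => ?_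
    rw [intervalIntegral.integral_const_mul, integral_samplePoly_mul_cos ha ha2 hs]
    push_cast
    rw [sub_mul]
    ring
  have h0 : 0 ≤ 2 * Real.pi * ∑ l ∈ S, ∑ m ∈ S, c l * c m * a (l * s - m * s) := by
    rw [e]
    exact intervalIntegral.integral_nonneg Real.two_pi_pos.le
      fun θ _ => mul_nonneg (hpos θ) (by positivity)
  exact nonneg_of_mul_nonneg_right h0 Real.two_pi_pos

/-! ### Finite combinations of shifted hat functions -/

/-- The spline `t ↦ ∑_{l ∈ S} c_l Q₂ (t + l s)`. -/
noncomputable def hatSum (S : Finset ℤ) (c : ℤ → ℝ) (s t : ℝ) : ℝ :=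
  ∑ l ∈ S, c l * bspline 2 (t + l * s)

/-- The almost everywhere derivative of `hatSum S c s`. -/
noncomputable def hatSumDeriv (S : Finset ℤ) (c : ℤ → ℝ) (s t : ℝ) : ℝ :=
  ∑ l ∈ S, c l * hatDeriv (t + l * s)

theorem continuous_hatSum (S : Finset ℤ) (c : ℤ → ℝ) (s : ℝ) : Continuous (hatSum S c s) := by
  have := continuous_bspline_two
  unfold hatSum; fun_prop

theorem integrable_bspline_two_mul_shift (a b : ℝ) :
    Integrable fun t => bspline 2 (t + a) * bspline 2 (t + b) := by
  refine (integrable_bspline_two.comp_add_right b).bdd_mul (c := 1)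
    (integrable_bspline_two.comp_add_right a).1 (Filter.Eventually.of_forall fun t => ?_)
  rw [Real.norm_of_nonneg (bspline_two_nonneg _)]
  exact bspline_two_le_one _

/-- Squared norm of a combination of translates in terms of the autocorrelation `r`. -/
theorem integral_sum_shift_sq {f r : ℝ → ℝ}
    (hi : ∀ a b, Integrable fun t => f (t + a) * f (t + b))
    (hr : ∀ a b, ∫ t, f (t + a) * f (t + b) = r (a - b)) (S : Finset ℤ) (c : ℤ → ℝ) (s : ℝ) :
    Integrable (fun t => (∑ l ∈ S, c l * f (t + l * s)) ^ 2) ∧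
    ∫ t, (∑ l ∈ S, c l * f (t + l * s)) ^ 2
      = ∑ l ∈ S, ∑ m ∈ S, c l * c m * r (l * s - m * s) := by
  have e : (fun t => (∑ l ∈ S, c l * f (t + l * s)) ^ 2) = fun t =>
      ∑ l ∈ S, ∑ m ∈ S, c l * c m * (f (t + l * s) * f (t + m * s)) := by
    ext t
    rw [sq, Finset.sum_mul_sum]
    refine Finset.sum_congr rfl fun l _ => Finset.sum_congr rfl fun m _ => ?_
    ring
  rw [e]
  have h2 (l : ℤ) : Integrable fun t =>
      ∑ m ∈ S, c l * c m * (f (t + l * s) * f (t + m * s)) :=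
    integrable_finsetSum _ fun m _ => (hi _ _).const_mul _
  refine ⟨integrable_finsetSum _ fun l _ => h2 l, ?_⟩
  rw [integral_finsetSum _ fun l _ => h2 l]
  refine Finset.sum_congr rfl fun l _ => ?_
  rw [integral_finsetSum _ fun m _ => (hi _ _).const_mul _]
  refine Finset.sum_congr rfl fun m _ => ?_
  rw [integral_const_mul, hr]

theorem integrable_hatSum_sq (S : Finset ℤ) (c : ℤ → ℝ) (s : ℝ) :
    Integrable fun t => hatSum S c s t ^ 2 :=
  (integral_sum_shift_sq integrable_bspline_two_mul_shift integral_bspline_two_mul_shift S c s).1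

theorem integrable_hatSumDeriv_sq (S : Finset ℤ) (c : ℤ → ℝ) (s : ℝ) :
    Integrable fun t => hatSumDeriv S c s t ^ 2 :=
  (integral_sum_shift_sq integrable_hatDeriv_mul_shift integral_hatDeriv_mul_shift S c s).1

theorem integral_hatSum_sq (S : Finset ℤ) (c : ℤ → ℝ) (s : ℝ) :
    ∫ t, hatSum S c s t ^ 2 = ∑ l ∈ S, ∑ m ∈ S, c l * c m * bspline 4 (l * s - m * s) :=
  (integral_sum_shift_sq integrable_bspline_two_mul_shift integral_bspline_two_mul_shift S c s).2

theorem integral_hatSumDeriv_sq (S : Finset ℤ) (c : ℤ → ℝ) (s : ℝ) :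
    ∫ t, hatSumDeriv S c s t ^ 2
      = ∑ l ∈ S, ∑ m ∈ S, c l * c m * negSecondDiff (l * s - m * s) :=
  (integral_sum_shift_sq integrable_hatDeriv_mul_shift integral_hatDeriv_mul_shift S c s).2

/-- **Bernstein inequality** for splines with knots adapted to the shifts `ℤ / β`. -/
theorem integral_hatSumDeriv_sq_le {β : ℝ} (hβ : 0 < β) (hβ2 : β < 2) (S : Finset ℤ)
    (c : ℤ → ℝ) :
    ∫ t, hatSumDeriv S c (1 / β) t ^ 2
      ≤ 4 * Real.pi ^ 2 * bernsteinConst (bsplineWindow 2) (1 / β)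
        * ∫ t, hatSum S c (1 / β) t ^ 2 := by
  set K := 4 * Real.pi ^ 2 * bernsteinConst (bsplineWindow 2) (1 / β) with hK
  have h := toeplitz_form_nonneg (a := fun x => K * bspline 4 x - negSecondDiff x)
    (fun x => by simp only [bspline_four_neg, negSecondDiff_neg])
    (fun x hx => by simp only [bspline_four_eq_zero hx, negSecondDiff_eq_zero hx]; ring)
    (half_lt_one_div hβ hβ2)
    (fun θ => by
      have e : samplePoly (fun x => K * bspline 4 x - negSecondDiff x) (1 / β) θ
          = K * samplePoly (bspline 4) (1 / β) θ - samplePoly negSecondDiff (1 / β) θ := by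
        simp only [samplePoly, Finset.mul_sum, ← Finset.sum_sub_distrib]
        exact Finset.sum_congr rfl fun n _ => by ring
      rw [e, sub_nonneg]
      exact samplePoly_negSecondDiff_le hβ hβ2 θ) S c
  rw [integral_hatSumDeriv_sq, integral_hatSum_sq, ← sub_nonneg]
  refine h.trans_eq ?_
  simp only [Finset.mul_sum, ← Finset.sum_sub_distrib]
  exact Finset.sum_congr rfl fun l _ => Finset.sum_congr rfl fun m _ => by ring

/-- The lower Riesz bound for the shifts of the hat function. -/
theorem exists_le_integral_hatSum_sq {β : ℝ} (hβ : 0 < β) (hβ2 : β < 2) :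
    ∃ κ : ℝ, 0 < κ ∧ ∀ (S : Finset ℤ) (c : ℤ → ℝ),
      κ * ∑ l ∈ S, c l ^ 2 ≤ ∫ t, hatSum S c (1 / β) t ^ 2 := by
  obtain ⟨κ, hκ, hle⟩ := exists_le_samplePoly_bspline_four hβ hβ2
  refine ⟨κ, hκ, fun S c => ?_⟩
  have hs := half_lt_one_div hβ hβ2
  have hsne : 1 / β ≠ 0 := by positivity
  have h := toeplitz_form_nonneg (a := fun x => bspline 4 x - if x = 0 then κ else 0)
    (fun x => by simp only [bspline_four_neg, neg_eq_zero])
    (fun x hx => by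
      have hx0 : x ≠ 0 := by rintro rfl; simp at hx; linarith
      simp only [bspline_four_eq_zero hx, if_neg hx0]; ring)
    hs
    (fun θ => by
      have e : samplePoly (fun x => bspline 4 x - if x = 0 then κ else 0) (1 / β) θ
          = samplePoly (bspline 4) (1 / β) θ - κ := by
        simp only [samplePoly, sub_mul, Finset.sum_sub_distrib, mul_eq_zero, hsne, or_false,
          Int.cast_eq_zero, ite_mul, zero_mul]
        simp
      rw [e, sub_nonneg]
      exact hle θ) S c
  rw [integral_hatSum_sq, ← sub_nonneg]
  refine h.trans_eq ?_
  rw [Finset.mul_sum, ← Finset.sum_sub_distrib]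
  refine Finset.sum_congr rfl fun l hl => ?_
  simp only [mul_sub, Finset.sum_sub_distrib]
  congr 1
  have hiff (m : ℤ) : (l : ℝ) * (1 / β) - m * (1 / β) = 0 ↔ l = m := by
    rw [← sub_mul, mul_eq_zero, or_iff_left hsne, sub_eq_zero, Int.cast_inj]
  simp only [hiff, mul_ite, mul_zero, Finset.sum_ite_eq, if_pos hl]
  ring

theorem hasDerivAt_bspline_two {x : ℝ} (hx : x ∉ ({-1, 0, 1} : Set ℝ)) :
    HasDerivAt (bspline 2) (hatDeriv x) x := by
  simp only [mem_insert_iff, mem_singleton_iff, not_or] at hx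
  obtain ⟨h1, h2, h3⟩ := hx
  have hb {y : ℝ} (hy : 1 / 2 < |y|) : unitBox y = 0 := by
    refine indicator_of_notMem ?_ _
    rw [mem_Icc, ← abs_le]
    exact hy.not_ge
  have hb1 {y : ℝ} (hy : |y| ≤ 1 / 2) : unitBox y = 1 := by
    have : y ∈ Icc (-(1 / 2) : ℝ) (1 / 2) := abs_le.1 hy
    exact indicator_of_mem this _
  unfold hatDeriv
  rcases lt_or_gt_of_ne h1 with h | h
  · rw [hb (by rw [lt_abs]; right; linarith), hb (by rw [lt_abs]; right; linarith), sub_zero]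
    refine (hasDerivAt_const x (0 : ℝ)).congr_of_eventuallyEq ?_
    filter_upwards [Iio_mem_nhds h] with u hu
    exact bspline_two_eq_zero (by rw [le_abs]; right; linarith [mem_Iio.1 hu])
  rcases lt_or_gt_of_ne h2 with h' | h'
  · rw [hb1 (by rw [abs_le]; constructor <;> linarith), hb (by rw [lt_abs]; right; linarith),
      sub_zero]
    refine ((hasDerivAt_id x).const_add 1).congr_of_eventuallyEq ?_
    filter_upwards [Ioo_mem_nhds h h'] with u hu
    rw [bspline_two, abs_of_neg hu.2, id, max_eq_right (by linarith [hu.1])]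
    ring
  rcases lt_or_gt_of_ne h3 with h'' | h''
  · rw [hb (by rw [lt_abs]; left; linarith), hb1 (by rw [abs_le]; constructor <;> linarith),
      zero_sub]
    refine ((hasDerivAt_id x).const_sub 1).congr_of_eventuallyEq ?_
    filter_upwards [Ioo_mem_nhds h' h''] with u hu
    rw [bspline_two, abs_of_pos hu.1, id, max_eq_right (by linarith [hu.2])]
  · rw [hb (by rw [lt_abs]; left; linarith), hb (by rw [lt_abs]; left; linarith), sub_zero]
    refine (hasDerivAt_const x (0 : ℝ)).congr_of_eventuallyEq ?_
    filter_upwards [Ioi_mem_nhds h''] with u hu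
    exact bspline_two_eq_zero (by rw [le_abs]; left; exact (mem_Ioi.1 hu).le)

theorem exists_countable_hasDerivAt_hatSum (S : Finset ℤ) (c : ℤ → ℝ) (s : ℝ) :
    ∃ N : Set ℝ, N.Countable ∧ ∀ t ∉ N, HasDerivAt (hatSum S c s) (hatSumDeriv S c s t) t := by
  refine ⟨⋃ l : ℤ, (fun t => t + l * s) ⁻¹' {-1, 0, 1}, ?_, fun t ht => ?_⟩
  · refine countable_iUnion fun l => Countable.preimage_of_injOn ?_ (add_left_injective _).injOn
    simp
  · simp only [mem_iUnion, mem_preimage, not_exists] at ht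
    unfold hatSumDeriv hatSum
    exact HasDerivAt.fun_sum fun l _ =>
      ((hasDerivAt_bspline_two (ht l)).comp_add_const t (l * s)).const_mul (c l)

theorem integrable_hatSumDeriv (S : Finset ℤ) (c : ℤ → ℝ) (s : ℝ) :
    Integrable (hatSumDeriv S c s) := by
  unfold hatSumDeriv hatDeriv
  exact integrable_finsetSum _ fun l _ =>
    (((integrable_unitBox.comp_add_right (1 / 2)).sub
      (integrable_unitBox.comp_sub_right (1 / 2))).comp_add_right (l * s)).const_mul _

/-! ### Wirtinger's inequality -/

/-- Wirtinger's inequality on an interval at whose left endpoint the function vanishes, with any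
constant short of the optimal one. With `w (t) = -c tan (c (t - a - L))`, the square
`(u' - w u)²` is `u'² - c² u² - (w u²)'`, and `w u²` vanishes at both endpoints. -/
theorem wirtinger_left_of_lt {u u' : ℝ → ℝ} {N : Set ℝ} (hN : N.Countable) (hu : Continuous u)
    (hd : ∀ t ∉ N, HasDerivAt u (u' t) t) (hi : Integrable u')
    (hi2 : Integrable fun t => u' t ^ 2) {a L : ℝ} (hL : 0 < L) (h0 : u a = 0) {c : ℝ}
    (hc0 : 0 < c) (hc : c < Real.pi / (2 * L)) :
    c ^ 2 * ∫ t in a..(a + L), u t ^ 2 ≤ ∫ t in a..(a + L), u' t ^ 2 := by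
  set w : ℝ → ℝ := fun t => -(c * Real.tan (c * (t - (a + L)))) with hw
  have hcL : c * L < Real.pi / 2 := by
    rw [lt_div_iff₀ (by positivity)] at hc; linarith
  have hcos : ∀ t ∈ Icc a (a + L), Real.cos (c * (t - (a + L))) ≠ 0 := by
    rintro t ⟨h1, h2⟩
    refine (Real.cos_pos_of_mem_Ioo ⟨?_, ?_⟩).ne'
    · nlinarith
    · nlinarith [Real.pi_pos]
  have hwd : ∀ t ∈ Icc a (a + L), HasDerivAt w (-c ^ 2 - w t ^ 2) t := by
    intro t ht
    have h1 := (Real.hasDerivAt_tan (hcos t ht)).comp t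
      (((hasDerivAt_id t).sub_const (a + L)).const_mul c)
    convert! (h1.const_mul c).neg using 1
    simp only [hw]
    rw [Real.tan_eq_sin_div_cos]
    have := hcos t ht
    field_simp
    rw [Real.sin_sq]
    ring
  have hwc : ContinuousOn w (Icc a (a + L)) := fun t ht =>
    (hwd t ht).continuousAt.continuousWithinAt
  have hle : a ≤ a + L := by linarith
  have hI := hi.intervalIntegrable (a := a) (b := a + L)
  have hI2 := hi2.intervalIntegrable (a := a) (b := a + L)
  have hU : IntervalIntegrable (fun t => u t ^ 2) volume a (a + L) :=
    Continuous.intervalIntegrable (by fun_prop) _ _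
  have hV : IntervalIntegrable
      (fun t => (2 * (w t * u t)) * u' t + (-c ^ 2 - w t ^ 2) * u t ^ 2) volume a (a + L) := by
    refine (hI.continuousOn_mul ?_).add (ContinuousOn.intervalIntegrable ?_)
    · rw [uIcc_of_le hle]; fun_prop
    · rw [uIcc_of_le hle]; fun_prop
  have hftc := integral_eq_of_hasDerivAt_off_countable_of_le (fun t => w t * u t ^ 2)
    (fun t => (2 * (w t * u t)) * u' t + (-c ^ 2 - w t ^ 2) * u t ^ 2) hle hN (by fun_prop)
    (fun t ht => by
      have := (hwd t (Ioo_subset_Icc_self ht.1)).mul ((hd t ht.2).fun_pow 2)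
      convert! this using 1
      push_cast
      ring) hV
  have hend : w (a + L) = 0 := by simp [hw]
  simp only [hend, h0] at hftc
  have hnn : 0 ≤ ∫ t in a..(a + L), (u' t - w t * u t) ^ 2 :=
    intervalIntegral.integral_nonneg hle fun t _ => sq_nonneg _
  have e : ∫ t in a..(a + L), (u' t - w t * u t) ^ 2
      = ∫ t in a..(a + L), (u' t ^ 2 - c ^ 2 * u t ^ 2
        - ((2 * (w t * u t)) * u' t + (-c ^ 2 - w t ^ 2) * u t ^ 2)) :=
    intervalIntegral.integral_congr fun t _ => by ring
  rw [e, intervalIntegral.integral_sub (hI2.sub (hU.const_mul _)) hV, hftc,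
    intervalIntegral.integral_sub hI2 (hU.const_mul _), intervalIntegral.integral_const_mul] at hnn
  linarith

theorem wirtinger_left {u u' : ℝ → ℝ} {N : Set ℝ} (hN : N.Countable) (hu : Continuous u)
    (hd : ∀ t ∉ N, HasDerivAt u (u' t) t) (hi : Integrable u')
    (hi2 : Integrable fun t => u' t ^ 2) {a L : ℝ} (hL : 0 < L) (h0 : u a = 0) :
    (Real.pi / (2 * L)) ^ 2 * ∫ t in a..(a + L), u t ^ 2 ≤ ∫ t in a..(a + L), u' t ^ 2 := by
  have hp : 0 < Real.pi / (2 * L) := by have := Real.pi_pos; positivity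
  have ht : Filter.Tendsto (fun c : ℝ => c ^ 2 * ∫ t in a..(a + L), u t ^ 2)
      (nhdsWithin (Real.pi / (2 * L)) (Iio (Real.pi / (2 * L))))
      (nhds ((Real.pi / (2 * L)) ^ 2 * ∫ t in a..(a + L), u t ^ 2)) :=
    (Continuous.tendsto (by fun_prop) _).mono_left nhdsWithin_le_nhds
  refine le_of_tendsto ht ?_
  filter_upwards [Ioo_mem_nhdsLT hp] with c hc
  exact wirtinger_left_of_lt hN hu hd hi hi2 hL h0 hc.1 hc.2

/-- Wirtinger's inequality on an interval at whose midpoint the function vanishes. -/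
theorem wirtinger_mid {u u' : ℝ → ℝ} {N : Set ℝ} (hN : N.Countable) (hu : Continuous u)
    (hd : ∀ t ∉ N, HasDerivAt u (u' t) t) (hi : Integrable u')
    (hi2 : Integrable fun t => u' t ^ 2) {a L : ℝ} (hL : 0 < L) (h0 : u a = 0) :
    (Real.pi / (2 * L)) ^ 2 * ∫ t in (a - L)..(a + L), u t ^ 2
      ≤ ∫ t in (a - L)..(a + L), u' t ^ 2 := by
  have hr := wirtinger_left hN hu hd hi hi2 hL h0
  have hl := wirtinger_left (u := fun t => u (-t)) (u' := fun t => -u' (-t)) (N := -N) (a := -a)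
    (by rw [← image_neg_eq_neg]; exact hN.image _) (by fun_prop)
    (fun t ht => by
      have h1 := (hd (-t) (by simpa using ht)).scomp t (hasDerivAt_neg t)
      convert! h1 using 1
      simp) hi.comp_neg.neg
    (by simpa using hi2.comp_neg) hL (by simpa using h0)
  rw [intervalIntegral.integral_comp_neg (fun t => u t ^ 2)] at hl
  have e : ∫ t in (-a)..(-a + L), (-u' (-t)) ^ 2 = ∫ t in (a - L)..a, u' t ^ 2 := by
    have := intervalIntegral.integral_comp_neg (fun t => (u' t) ^ 2) (a := -a) (b := -a + L)
    simp only [neg_sq]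
    rw [this]
    congr 1 <;> ring
  rw [e, neg_neg, show -(-a + L) = a - L by ring] at hl
  have hU : Continuous fun t => u t ^ 2 := by fun_prop
  rw [← intervalIntegral.integral_add_adjacent_intervals (hU.intervalIntegrable (a - L) a)
      (hU.intervalIntegrable a (a + L)), ← intervalIntegral.integral_add_adjacent_intervals
      (hi2.intervalIntegrable (a := a - L) (b := a)) hi2.intervalIntegrable, mul_add]
  exact add_le_add hl hr

/-! ### Sampling of splines -/

/-- The integral over `ℝ` as the sum of the integrals over the periods of `T ℤ + y`. -/
theorem hasSum_integral_periods {E : Type*} [NormedAddCommGroup E] [NormedSpace ℝ E]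
    {f : ℝ → E} (hf : Integrable f) {T : ℝ} (hT : 0 < T) (y : ℝ) :
    HasSum (fun n : ℤ => ∫ t in (y + n * T)..(y + n * T + T), f t) (∫ t, f t) := by
  have h := ((hf.comp_mul_left' hT.ne').hasSum_intervalIntegral (y / T)).const_smul T
  rw [Measure.integral_comp_mul_left, abs_of_pos (inv_pos.2 hT), smul_smul,
    mul_inv_cancel₀ hT.ne', one_smul] at h
  convert! h using 2 with n
  rw [intervalIntegral.integral_comp_mul_left _ hT.ne', smul_smul, mul_inv_cancel₀ hT.ne',
    one_smul]
  congr 1 <;> field_simp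

/-- A nonzero term `Q₂ (t + l s)` forces `l` into an interval of length `2 / s`. -/
theorem sum_bspline_two_shift_le {s : ℝ} (hs : 0 < s) (S : Finset ℤ) (t : ℝ) :
    ∑ l ∈ S, bspline 2 (t + l * s) ≤ 2 / s + 1 := by
  set I := Finset.Icc ⌈(-1 - t) / s⌉ ⌊(1 - t) / s⌋ with hI
  have h1 : ∑ l ∈ S, bspline 2 (t + l * s) ≤ ∑ l ∈ I, bspline 2 (t + l * s) := by
    rw [← Finset.sum_filter_add_sum_filter_not S (· ∈ I)]
    have hz : ∑ l ∈ S with l ∉ I, bspline 2 (t + l * s) = 0 := by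
      refine Finset.sum_eq_zero fun l hl => bspline_two_eq_zero ?_
      have hl' := (Finset.mem_filter.1 hl).2
      by_contra! hlt
      rw [abs_lt] at hlt
      refine hl' (Finset.mem_Icc.2 ⟨Int.ceil_le.2 ?_, Int.le_floor.2 ?_⟩)
      · rw [div_le_iff₀ hs]; linarith
      · rw [le_div_iff₀ hs]; linarith
    rw [hz, add_zero]
    exact Finset.sum_le_sum_of_subset_of_nonneg
      (fun l hl => (Finset.mem_filter.1 hl).2) fun l _ _ => bspline_two_nonneg _
  have h2 : ∑ l ∈ I, bspline 2 (t + l * s) ≤ I.card := by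
    simpa using Finset.sum_le_sum fun l (_ : l ∈ I) => bspline_two_le_one (t + l * s)
  refine h1.trans (h2.trans ?_)
  have h3 : ((1 - t) / s) - (-1 - t) / s = 2 / s := by ring
  have h4 := Int.floor_le ((1 - t) / s)
  have h5 := Int.le_ceil ((-1 - t) / s)
  have h6 : (0 : ℝ) < 2 / s := by positivity
  rw [hI, Int.card_Icc]
  rcases le_total (⌊(1 - t) / s⌋ + 1 - ⌈(-1 - t) / s⌉) 0 with h | h
  · rw [Int.toNat_of_nonpos h]; push_cast; linarith
  · have : (((⌊(1 - t) / s⌋ + 1 - ⌈(-1 - t) / s⌉).toNat : ℤ) : ℝ)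
        = ((⌊(1 - t) / s⌋ + 1 - ⌈(-1 - t) / s⌉ : ℤ) : ℝ) := by rw [Int.toNat_of_nonneg h]
    rw [Int.cast_natCast] at this
    rw [this]
    push_cast
    linarith

/-- The upper bound for the samples, by the Cauchy-Schwarz inequality: both the translates by
`s ℤ` and those by `α ℤ` of the hat function overlap boundedly often. -/
theorem sum_hatSum_sq_le {s α : ℝ} (hs : 0 < s) (hα : 0 < α) (S K : Finset ℤ) (c : ℤ → ℝ)
    (x : ℝ) : ∑ k ∈ K, hatSum S c s (x - α * k) ^ 2
      ≤ (2 / s + 1) * (2 / α + 1) * ∑ l ∈ S, c l ^ 2 := by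
  have hCs : 0 ≤ 2 / s + 1 := by positivity
  have h1 (t : ℝ) :
      hatSum S c s t ^ 2 ≤ (2 / s + 1) * ∑ l ∈ S, c l ^ 2 * bspline 2 (t + l * s) := by
    have hcs := Finset.sum_sq_le_sum_mul_sum_of_sq_le_mul S
      (r := fun l => c l * bspline 2 (t + l * s)) (f := fun l => bspline 2 (t + l * s))
      (g := fun l => c l ^ 2 * bspline 2 (t + l * s)) (fun l _ => bspline_two_nonneg _)
      (fun l _ => mul_nonneg (sq_nonneg _) (bspline_two_nonneg _)) (fun l _ => le_of_eq (by ring))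
    refine hcs.trans (mul_le_mul_of_nonneg_right (sum_bspline_two_shift_le hs S t) ?_)
    exact Finset.sum_nonneg fun l _ => mul_nonneg (sq_nonneg _) (bspline_two_nonneg _)
  refine (Finset.sum_le_sum fun (k : ℤ) _ => h1 (x - α * k)).trans ?_
  rw [← Finset.mul_sum, mul_assoc]
  refine mul_le_mul_of_nonneg_left ?_ hCs
  rw [Finset.sum_comm, Finset.mul_sum]
  refine Finset.sum_le_sum fun l _ => ?_
  rw [← Finset.mul_sum, mul_comm]
  refine mul_le_mul_of_nonneg_right ?_ (sq_nonneg _)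
  refine le_trans (le_of_eq ?_) (sum_bspline_two_shift_le hα K (-(x + l * s)))
  refine Finset.sum_congr rfl fun k _ => ?_
  rw [← bspline_two_neg]
  congr 1
  ring

theorem summable_hatSum_sq {s α : ℝ} (hs : 0 < s) (hα : 0 < α) (S : Finset ℤ) (c : ℤ → ℝ)
    (x : ℝ) : Summable fun k : ℤ => hatSum S c s (x - α * k) ^ 2 :=
  summable_of_sum_le (fun _ => sq_nonneg _) fun K => sum_hatSum_sq_le hs hα S K c x

/-- The local sampling estimate on an interval of length `α` around a sampling point. -/
theorem integral_sq_le_of_sample {u u' : ℝ → ℝ} {N : Set ℝ} (hN : N.Countable) (hu : Continuous u)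
    (hd : ∀ t ∉ N, HasDerivAt u (u' t) t) (hi : Integrable u')
    (hi2 : Integrable fun t => u' t ^ 2) {α ε : ℝ} (hα : 0 < α) (hε : 0 < ε) (a : ℝ) :
    ∫ t in (a - α / 2)..(a + α / 2), u t ^ 2
      ≤ (1 + ε) * (α / Real.pi) ^ 2 * (∫ t in (a - α / 2)..(a + α / 2), u' t ^ 2)
        + (1 + 1 / ε) * α * u a ^ 2 := by
  have hpi := Real.pi_pos
  have hw := wirtinger_mid hN (u := fun t => u t - u a) (by fun_prop)
    (fun t ht => (hd t ht).sub_const (u a)) hi hi2 (a := a) (half_pos hα) (sub_self _)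
  have hpt (t : ℝ) : u t ^ 2 ≤ (1 + ε) * (u t - u a) ^ 2 + (1 + 1 / ε) * u a ^ 2 := by
    have : (1 + ε) * (u t - u a) ^ 2 + (1 + 1 / ε) * u a ^ 2 - u t ^ 2
        = (ε * (u t - u a) - u a) ^ 2 / ε := by field_simp; ring
    have h2 : 0 ≤ (ε * (u t - u a) - u a) ^ 2 / ε := by positivity
    linarith
  have h1 : ∫ t in (a - α / 2)..(a + α / 2), u t ^ 2
      ≤ ∫ t in (a - α / 2)..(a + α / 2),
        ((1 + ε) * (u t - u a) ^ 2 + (1 + 1 / ε) * u a ^ 2) :=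
    intervalIntegral.integral_mono_on (by linarith)
      (Continuous.intervalIntegrable (by fun_prop) _ _)
      (Continuous.intervalIntegrable (by fun_prop) _ _) fun t _ => hpt t
  rw [intervalIntegral.integral_add (Continuous.intervalIntegrable (by fun_prop) _ _)
    (Continuous.intervalIntegrable (by fun_prop) _ _), intervalIntegral.integral_const_mul,
    intervalIntegral.integral_const, smul_eq_mul] at h1
  have h2 : ∫ t in (a - α / 2)..(a + α / 2), (u t - u a) ^ 2
      ≤ (α / Real.pi) ^ 2 * ∫ t in (a - α / 2)..(a + α / 2), u' t ^ 2 := by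
    have := mul_le_mul_of_nonneg_left hw (sq_nonneg (α / Real.pi))
    rwa [← mul_assoc, ← mul_pow, show α / Real.pi * (Real.pi / (2 * (α / 2))) = 1 by field_simp,
      one_pow, one_mul] at this
  have h3 := mul_le_mul_of_nonneg_left h2 (by linarith : 0 ≤ 1 + ε)
  refine h1.trans ?_
  rw [mul_assoc (1 + ε)]
  refine add_le_add h3 (le_of_eq ?_)
  ring

/-- **Sampling inequality**: the step function through the samples on `x + α ℤ` approximates the
spline `F` within `(α / π) ‖F'‖ ≤ 2 α √M ‖F‖`, which is less than `‖F‖`. -/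
theorem exists_sampling_lower_bound {β : ℝ} (hβ : 0 < β) (hβ2 : β < 2) {α : ℝ} (hα : 0 < α)
    (hαM : α < 1 / (2 * √(bernsteinConst (bsplineWindow 2) (1 / β)))) :
    ∃ A : ℝ, 0 < A ∧ ∀ (S : Finset ℤ) (c : ℤ → ℝ) (x : ℝ),
      A * ∑ l ∈ S, c l ^ 2 ≤ ∑' k : ℤ, hatSum S c (1 / β) (x - α * k) ^ 2 := by
  set M := bernsteinConst (bsplineWindow 2) (1 / β) with hM
  have hpi := Real.pi_pos
  have hMpos : 0 < M := by
    by_contra! h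
    rw [Real.sqrt_eq_zero_of_nonpos h] at hαM
    simp at hαM
    linarith
  have hsM : 0 < √M := Real.sqrt_pos.2 hMpos
  have hq : 4 * α ^ 2 * M < 1 := by
    rw [lt_div_iff₀ (by positivity)] at hαM
    have h1 : (α * (2 * √M)) ^ 2 < 1 := by
      rw [sq_lt_one_iff₀ (by positivity)]; exact hαM
    rw [mul_pow, mul_pow, Real.sq_sqrt hMpos.le] at h1
    linarith
  obtain ⟨κ, hκ, hκle⟩ := exists_le_integral_hatSum_sq hβ hβ2
  set q := 4 * α ^ 2 * M with hqdef
  have hq0 : 0 < q := by positivity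
  -- `(1 + ε) q = (1 + q) / 2 < 1`
  obtain ⟨ε, hε⟩ : ∃ ε, ε = (1 - q) / (2 * q) := ⟨_, rfl⟩
  have hε0 : 0 < ε := by
    rw [hε]; exact div_pos (by linarith) (by linarith)
  have hεq : (1 + ε) * q = (1 + q) / 2 := by rw [hε]; field_simp; ring
  have hD : 0 < (1 + 1 / ε) * α := by positivity
  refine ⟨(1 - q) / 2 * κ / ((1 + 1 / ε) * α), ?_, fun S c x => ?_⟩
  · have : 0 < (1 - q) / 2 := by linarith
    positivity
  obtain ⟨N, hN, hd⟩ := exists_countable_hasDerivAt_hatSum S c (1 / β)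
  set F := hatSum S c (1 / β) with hF
  set F' := hatSumDeriv S c (1 / β) with hF'
  have hi2 := integrable_hatSumDeriv_sq S c (1 / β)
  have hloc (k : ℤ) := integral_sq_le_of_sample hN (continuous_hatSum S c (1 / β)) hd
    (integrable_hatSumDeriv S c (1 / β)) hi2 hα hε0 (x - α * k)
  have hper {f : ℝ → ℝ} (hf : Integrable f) :
      HasSum (fun k : ℤ => ∫ t in (x - α * k - α / 2)..(x - α * k + α / 2), f t) (∫ t, f t) := by
    have h := (Equiv.neg ℤ).hasSum_iff.2 (hasSum_integral_periods hf hα (x - α / 2))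
    convert! h using 2 with k
    simp only [Function.comp, Equiv.neg_apply]
    push_cast
    congr 1 <;> ring
  have hsum := hasSum_le hloc (hper (integrable_hatSum_sq S c (1 / β)))
    (((hper hi2).mul_left ((1 + ε) * (α / Real.pi) ^ 2)).add
      ((summable_hatSum_sq (by positivity : 0 < 1 / β) hα S c x).hasSum.mul_left
        ((1 + 1 / ε) * α)))
  have hB := integral_hatSumDeriv_sq_le hβ hβ2 S c
  have hR := hκle S c
  rw [← hF] at hB hR hsum
  rw [← hM] at hB
  have h1 := mul_le_mul_of_nonneg_left hB (by positivity : 0 ≤ (1 + ε) * (α / Real.pi) ^ 2)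
  have h2 : (1 + ε) * (α / Real.pi) ^ 2 * (4 * Real.pi ^ 2 * M * ∫ t, F t ^ 2)
      = (1 + q) / 2 * ∫ t, F t ^ 2 := by
    rw [← hεq, hqdef]; field_simp
  rw [h2] at h1
  have h3 : (1 - q) / 2 * ∫ t, F t ^ 2
      ≤ (1 + 1 / ε) * α * ∑' k : ℤ, F (x - α * k) ^ 2 := by linarith
  rw [div_mul_eq_mul_div, div_le_iff₀ hD, mul_assoc, mul_comm (∑' k : ℤ, _)]
  exact (mul_le_mul_of_nonneg_left hR (by linarith)).trans h3

/-! ### Frames from dense subsets -/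

/-- The frame inequalities extend from a dense subset to the whole space. Halving the lower bound
permits the use of `‖x + y‖² ≤ 2 ‖x‖² + 2 ‖y‖²` instead of the triangle inequality in `ℓ²`. -/
theorem isHilbertFrame_of_dense {ι H : Type*} [NormedAddCommGroup H] [InnerProductSpace ℂ H]
    {e : ι → H} {D : Set H} (hD : Dense D) {A B : ℝ} (hA : 0 < A) (hB : 0 < B)
    (h : ∀ f ∈ D, Summable (fun i => ‖inner ℂ (e i) f‖ ^ 2) ∧
      A * ‖f‖ ^ 2 ≤ ∑' i, ‖inner ℂ (e i) f‖ ^ 2 ∧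
      ∑' i, ‖inner ℂ (e i) f‖ ^ 2 ≤ B * ‖f‖ ^ 2) : IsHilbertFrame e := by
  have hfin (I : Finset ι) (f : H) : ∑ i ∈ I, ‖inner ℂ (e i) f‖ ^ 2 ≤ B * ‖f‖ ^ 2 := by
    have hc : IsClosed {f : H | ∑ i ∈ I, ‖inner ℂ (e i) f‖ ^ 2 ≤ B * ‖f‖ ^ 2} :=
      isClosed_le (by fun_prop) (by fun_prop)
    refine hc.closure_subset_iff.2 (fun d hd => ?_) (hD f)
    exact ((h d hd).1.sum_le_tsum I fun _ _ => sq_nonneg _).trans (h d hd).2.2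
  have hsum (f : H) : Summable fun i => ‖inner ℂ (e i) f‖ ^ 2 :=
    summable_of_sum_le (fun _ => sq_nonneg _) fun I => hfin I f
  have hle (f : H) : ∑' i, ‖inner ℂ (e i) f‖ ^ 2 ≤ B * ‖f‖ ^ 2 :=
    (hsum f).tsum_le_of_sum_le fun I => hfin I f
  refine ⟨A / 2, B, half_pos hA, hB, fun f => ⟨hsum f, ?_, hle f⟩⟩
  have hc : IsClosed {d : H | A * ‖d‖ ^ 2
      ≤ 2 * (∑' i, ‖inner ℂ (e i) f‖ ^ 2) + 2 * (B * ‖d - f‖ ^ 2)} :=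
    isClosed_le (by fun_prop) (by fun_prop)
  have hf := hc.closure_subset_iff.2 (fun d hd => ?_) (hD f)
  · simp only [mem_ofPred_eq, sub_self, norm_zero] at hf
    linarith
  · refine (h d hd).2.1.trans ?_
    have h1 : ∑' i, ‖inner ℂ (e i) d‖ ^ 2
        ≤ ∑' i, (2 * ‖inner ℂ (e i) f‖ ^ 2 + 2 * ‖inner ℂ (e i) (d - f)‖ ^ 2) := by
      refine (hsum d).tsum_le_tsum (fun i => ?_)
        (((hsum f).mul_left 2).add ((hsum (d - f)).mul_left 2))
      have h2 : ‖inner ℂ (e i) d‖ ≤ ‖inner ℂ (e i) f‖ + ‖inner ℂ (e i) (d - f)‖ := by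
        rw [show inner ℂ (e i) d = inner ℂ (e i) f + inner ℂ (e i) (d - f) by
          rw [← inner_add_right, add_sub_cancel]]
        exact norm_add_le _ _
      nlinarith [sq_nonneg (‖inner ℂ (e i) f‖ - ‖inner ℂ (e i) (d - f)‖),
        norm_nonneg (inner ℂ (e i) d)]
    rw [((hsum f).mul_left 2).tsum_add ((hsum (d - f)).mul_left 2), tsum_mul_left,
      tsum_mul_left] at h1
    have := hle (d - f)
    linarith

/-! ### The fiber inequality -/

/-- The Ron-Shen fiber inequality: for every `x`, the finitely supported sequences `c` satisfy
a two-sided bound for `∑_k |∑_l c_l Q₂ (x + l / β - α k)|²`. -/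
theorem exists_fiber_bounds {β : ℝ} (hβ : 0 < β) (hβ2 : β < 2) {α : ℝ} (hα : 0 < α)
    (hαM : α < 1 / (2 * √(bernsteinConst (bsplineWindow 2) (1 / β)))) :
    ∃ A B : ℝ, 0 < A ∧ 0 < B ∧ ∀ (S : Finset ℤ) (c : ℤ → ℂ) (x : ℝ),
      A * ∑ l ∈ S, ‖c l‖ ^ 2
        ≤ ∑' k : ℤ, ‖∑ l ∈ S, c l * bsplineWindow 2 (x + l * (1 / β) - α * k)‖ ^ 2 ∧
      ∑' k : ℤ, ‖∑ l ∈ S, c l * bsplineWindow 2 (x + l * (1 / β) - α * k)‖ ^ 2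
        ≤ B * ∑ l ∈ S, ‖c l‖ ^ 2 := by
  obtain ⟨A, hA, hle⟩ := exists_sampling_lower_bound hβ hβ2 hα hαM
  have hs : 0 < 1 / β := by positivity
  refine ⟨A, (2 / (1 / β) + 1) * (2 / α + 1), hA, by positivity, fun S c x => ?_⟩
  have hre (l : ℤ) : ‖c l‖ ^ 2 = (c l).re ^ 2 + (c l).im ^ 2 := by
    rw [← Complex.normSq_eq_norm_sq, Complex.normSq_apply]; ring
  have hterm (k : ℤ) : ‖∑ l ∈ S, c l * bsplineWindow 2 (x + l * (1 / β) - α * k)‖ ^ 2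
      = hatSum S (fun l => (c l).re) (1 / β) (x - α * k) ^ 2
        + hatSum S (fun l => (c l).im) (1 / β) (x - α * k) ^ 2 := by
    rw [← Complex.normSq_eq_norm_sq, Complex.normSq_apply, Complex.re_sum, Complex.im_sum]
    simp only [bsplineWindow, Complex.re_mul_ofReal, Complex.im_mul_ofReal, hatSum, ← sq,
      sub_add_eq_add_sub]
  have h1 := summable_hatSum_sq hs hα S (fun l => (c l).re) x
  have h2 := summable_hatSum_sq hs hα S (fun l => (c l).im) x
  simp only [hterm, hre, Finset.sum_add_distrib, h1.tsum_add h2]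
  rw [mul_add, mul_add]
  refine ⟨add_le_add (hle _ _ _) (hle _ _ _), add_le_add ?_ ?_⟩
  · exact h1.tsum_le_of_sum_le fun K => sum_hatSum_sq_le hs hα S K _ x
  · exact h2.tsum_le_of_sum_le fun K => sum_hatSum_sq_le hs hα S K _ x

/-! ### Gabor coefficients of compactly supported functions -/

theorem continuous_bsplineWindow_two : Continuous (bsplineWindow 2) :=
  Complex.continuous_ofReal.comp continuous_bspline_two

theorem bsplineWindow_two_eq_zero {x : ℝ} (hx : 1 ≤ |x|) : bsplineWindow 2 x = 0 := by
  rw [bsplineWindow, bspline_two_eq_zero hx, Complex.ofReal_zero]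

theorem memLp_gaborAtom (α β : ℝ) (k m : ℤ) :
    MemLp (gaborAtom (bsplineWindow 2) α β k m) 2 volume := by
  have hc := continuous_bsplineWindow_two
  have hcont : Continuous (gaborAtom (bsplineWindow 2) α β k m) := by
    unfold gaborAtom; fun_prop
  refine hcont.memLp_of_hasCompactSupport (HasCompactSupport.of_support_subset_isCompact
    (isCompact_Icc (a := α * k - 1) (b := α * k + 1)) fun x hx => ?_)
  by_contra h
  refine hx ?_
  have : 1 ≤ |x - α * k| := by
    by_contra! hlt
    rw [abs_lt] at hlt
    exact h ⟨by linarith, by linarith⟩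
  rw [gaborAtom, bsplineWindow_two_eq_zero this, mul_zero]

/-- Periodization of a compactly supported integral. -/
theorem integral_eq_integral_sum_shift {E : Type*} [NormedAddCommGroup E] [NormedSpace ℝ E]
    {g : ℝ → E} (hg : Continuous g) (hi : Integrable g) {T : ℝ} (hT : 0 < T) {S : Finset ℤ}
    (hS : ∀ l ∉ S, ∀ x ∈ Icc 0 T, g (x + l * T) = 0) :
    ∫ x, g x = ∫ x in (0 : ℝ)..T, ∑ l ∈ S, g (x + l * T) := by
  have hshift (l : ℤ) : ∫ t in (0 + l * T)..(0 + l * T + T), g t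
      = ∫ x in (0 : ℝ)..T, g (x + l * T) := by
    rw [intervalIntegral.integral_comp_add_right]
    congr 1; ring
  rw [← (hasSum_integral_periods hi hT 0).tsum_eq, tsum_eq_sum (s := S),
    intervalIntegral.integral_finsetSum
      fun l _ => Continuous.intervalIntegrable (by fun_prop) _ _]
  · exact Finset.sum_congr rfl fun l _ => hshift l
  · intro l hl
    rw [hshift]
    refine (intervalIntegral.integral_congr (g := fun _ => (0 : E)) fun x hx => ?_).trans
      intervalIntegral.integral_zero
    rw [uIcc_of_le hT.le] at hx
    exact hS l hl x hx

/-- **Parseval's identity** for the integrals `∫ g(x) e^{-2πi m x / T}`, in terms of the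
periodization of `g`. -/
theorem hasSum_sq_integral_exp {g : ℝ → ℂ} (hg : Continuous g) (hi : Integrable g) {T : ℝ}
    (hT : 0 < T) {S : Finset ℤ} (hS : ∀ l ∉ S, ∀ x ∈ Icc 0 T, g (x + l * T) = 0) :
    HasSum (fun m : ℤ => ‖∫ x : ℝ, Complex.exp (-(2 * Real.pi * Complex.I * m * x / T)) * g x‖ ^ 2)
      (T * ∫ x in (0 : ℝ)..T, ‖∑ l ∈ S, g (x + l * T)‖ ^ 2) := by
  have hTc : (T : ℂ) ≠ 0 := by exact_mod_cast hT.ne'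
  set P : ℝ → ℂ := fun x => ∑ l ∈ S, g (x + l * T) with hP
  have hPc : Continuous P := by fun_prop
  have hmem : MemLp P 2 (volume.restrict (Ioc 0 T)) :=
    (memLp_two_iff_integrable_sq_norm hPc.aestronglyMeasurable).2
      ((by fun_prop : Continuous fun x => ‖P x‖ ^ 2).intervalIntegrable 0 T).1
  have h := (hasSum_sq_fourierCoeffOn hT hmem).mul_left (T ^ 2)
  simp only [sub_zero, smul_eq_mul] at h
  rw [← mul_assoc, show T ^ 2 * T⁻¹ = T by field_simp] at h
  convert! h using 2 with m
  have hcoef : ∫ x : ℝ, Complex.exp (-(2 * Real.pi * Complex.I * m * x / T)) * g x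
      = T * fourierCoeffOn hT P m := by
    have hexp : Continuous fun x : ℝ => Complex.exp (-(2 * Real.pi * Complex.I * m * x / T)) := by
      fun_prop
    rw [integral_eq_integral_sum_shift (g := fun x : ℝ =>
        Complex.exp (-(2 * Real.pi * Complex.I * m * x / T)) * g x) (by fun_prop)
        (hi.bdd_mul (c := 1)
        hexp.aestronglyMeasurable (Filter.Eventually.of_forall fun x => ?_)) hT
        (fun l hl x hx => by rw [hS l hl x hx, mul_zero]), fourierCoeffOn_eq_integral, sub_zero,
      Complex.real_smul, ← mul_assoc]
    · push_cast
      rw [mul_one_div_cancel hTc, one_mul]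
      refine intervalIntegral.integral_congr fun x _ => ?_
      simp only [hP]
      rw [smul_eq_mul, Finset.mul_sum]
      refine Finset.sum_congr rfl fun l _ => ?_
      congr 1
      rw [fourier_coe_apply, Complex.exp_eq_exp_iff_exists_int]
      refine ⟨-(m * l), ?_⟩
      push_cast
      field_simp
      ring
    · have e : -(2 * Real.pi * Complex.I * m * x / T)
          = ((-(2 * Real.pi * m * x / T) : ℝ) : ℂ) * Complex.I := by push_cast; ring
      rw [e, Complex.norm_exp_ofReal_mul_I]
  rw [hcoef, norm_mul, Complex.norm_real, Real.norm_of_nonneg hT.le, mul_pow]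

/-- For continuous, compactly supported `f`, the squared Gabor coefficients sum to the integral of
the fiber sums over one period. Compact support makes the sum over translations `l ∈ S` of the
period and the sum over translations `k ∈ K` of the window finite. -/
theorem hasSum_sq_gabor_coeff {β : ℝ} (hβ : 0 < β) {α : ℝ} (hα : 0 < α) {f : ℝ → ℂ}
    (hf : Continuous f) (hfc : HasCompactSupport f) :
    ∃ S : Finset ℤ,
      ∫ x, ‖f x‖ ^ 2 = ∫ x in (0 : ℝ)..(1 / β), ∑ l ∈ S, ‖f (x + l * (1 / β))‖ ^ 2 ∧
      ∃ K : Finset ℤ,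
      (∀ x ∈ Icc 0 (1 / β), ∀ k ∉ K,
        ∑ l ∈ S, f (x + l * (1 / β)) * bsplineWindow 2 (x + l * (1 / β) - α * k) = 0) ∧
      HasSum (fun p : ℤ × ℤ =>
        ‖∫ x, starRingEnd ℂ (gaborAtom (bsplineWindow 2) α β p.1 p.2 x) * f x‖ ^ 2)
        (1 / β * ∫ x in (0 : ℝ)..(1 / β), ∑ k ∈ K,
          ‖∑ l ∈ S, f (x + l * (1 / β)) * bsplineWindow 2 (x + l * (1 / β) - α * k)‖ ^ 2) := by
  set T := 1 / β with hTdef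
  have hT : 0 < T := by positivity
  have hbc := continuous_bsplineWindow_two
  obtain ⟨R, hR0, hR⟩ := hfc.isBounded.exists_pos_norm_le
  have hfz {x : ℝ} (hx : R < |x|) : f x = 0 := by
    by_contra h
    exact hx.not_ge (hR x (subset_tsupport f h))
  -- Beyond `|l| ≤ n` the translates of the period miss the support of `f`.
  obtain ⟨n, hn⟩ := exists_nat_gt (R / T + 1)
  set S : Finset ℤ := Finset.Icc (-n) n with hSdef
  have hbig {l : ℤ} (hl : l ∉ S) {x : ℝ} (hx : x ∈ Icc 0 T) : R < |x + l * T| := by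
    have hl' : (n : ℤ) < |l| := by rw [hSdef, Finset.mem_Icc, ← abs_le] at hl; omega
    have hl2 : (n : ℝ) < |(l : ℝ)| := by exact_mod_cast hl'
    have h1 : R + T < |(l : ℝ) * T| := by
      rw [abs_mul, abs_of_pos hT]
      have h2 : R / T + 1 < |(l : ℝ)| := hn.trans hl2
      have h3 := mul_lt_mul_of_pos_right h2 hT
      rwa [add_mul, one_mul, div_mul_cancel₀ _ hT.ne'] at h3
    have h2 : |(l : ℝ) * T| ≤ |x + l * T| + |x| := by
      have := abs_sub (x + l * T) x
      rwa [add_sub_cancel_left] at this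
    have h3 : |x| ≤ T := by rw [abs_of_nonneg hx.1]; exact hx.2
    linarith
  have hS : ∀ l ∉ S, ∀ x ∈ Icc 0 T, f (x + l * T) = 0 := fun l hl x hx => hfz (hbig hl hx)
  refine ⟨S, ?_, ?_⟩
  · refine integral_eq_integral_sum_shift (g := fun x => ‖f x‖ ^ 2) (by fun_prop) ?_ hT
      fun l hl x hx => by rw [hS l hl x hx, norm_zero, sq, mul_zero]
    refine Continuous.integrable_of_hasCompactSupport (by fun_prop) ?_
    exact hfc.comp_left (g := fun z : ℂ => ‖z‖ ^ 2) (by simp)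
  -- Beyond `|k| ≤ N` the translated window misses the support of `f`.
  obtain ⟨N, hN⟩ := exists_nat_gt ((R + 1) / α)
  set K : Finset ℤ := Finset.Icc (-N) N with hKdef
  have hKz {k : ℤ} (hk : k ∉ K) (x : ℝ) : f x * bsplineWindow 2 (x - α * k) = 0 := by
    rcases lt_or_ge R |x| with hx | hx
    · rw [hfz hx, zero_mul]
    · have hk' : (N : ℤ) < |k| := by rw [hKdef, Finset.mem_Icc, ← abs_le] at hk; omega
      have hk2 : (N : ℝ) < |(k : ℝ)| := by exact_mod_cast hk'
      have h1 : R + 1 < |α * k| := by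
        rw [abs_mul, abs_of_pos hα, ← div_lt_iff₀' hα]
        exact hN.trans hk2
      have h2 : |α * k| ≤ |x - α * k| + |x| := by
        have := abs_sub (x - α * k) x
        rwa [sub_sub_cancel_left, abs_neg] at this
      rw [bsplineWindow_two_eq_zero (by linarith), mul_zero]
  refine ⟨K, fun x _ k hk => Finset.sum_eq_zero fun l _ => hKz hk _, ?_⟩
  have hcoeff (k m : ℤ) :
      ∫ x, starRingEnd ℂ (gaborAtom (bsplineWindow 2) α β k m x) * f x
      = ∫ x : ℝ, Complex.exp (-(2 * Real.pi * Complex.I * m * x / T))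
        * (f x * bsplineWindow 2 (x - α * k)) := by
    congr 1
    ext x
    rw [gaborAtom, map_mul, ← Complex.exp_conj, bsplineWindow, Complex.conj_ofReal, hTdef]
    simp only [map_mul, Complex.conj_ofReal, Complex.conj_I, map_ofNat, map_intCast]
    push_cast
    rw [show 2 * (Real.pi : ℂ) * -Complex.I * β * m * x
      = -(2 * Real.pi * Complex.I * m * x / (1 / β)) by
        rw [div_div_eq_mul_div, div_one]; ring]
    ring
  have hrow (k : ℤ) := hasSum_sq_integral_exp (g := fun x => f x * bsplineWindow 2 (x - α * k))
    (by fun_prop) (Continuous.integrable_of_hasCompactSupport (by fun_prop) hfc.mul_right) hT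
    (S := S) (fun l hl x hx => by rw [hS l hl x hx, zero_mul])
  simp only [← hcoeff] at hrow
  rw [intervalIntegral.integral_finsetSum
    fun k _ => Continuous.intervalIntegrable (by fun_prop) _ _, Finset.mul_sum]
  have hcol : HasSum (fun k : ℤ => T * ∫ x in (0 : ℝ)..T,
      ‖∑ l ∈ S, f (x + l * T) * bsplineWindow 2 (x + l * T - α * k)‖ ^ 2)
      (∑ k ∈ K, T * ∫ x in (0 : ℝ)..T,
        ‖∑ l ∈ S, f (x + l * T) * bsplineWindow 2 (x + l * T - α * k)‖ ^ 2) := by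
    refine hasSum_sum_of_ne_finset_zero fun k hk => ?_
    simp [hKz hk]
  have hsum : Summable fun p : ℤ × ℤ =>
      ‖∫ x, starRingEnd ℂ (gaborAtom (bsplineWindow 2) α β p.1 p.2 x) * f x‖ ^ 2 := by
    refine (summable_prod_of_nonneg fun p => sq_nonneg _).2 ⟨fun k => (hrow k).summable, ?_⟩
    simpa only [(hrow _).tsum_eq] using hcol.summable
  have := hsum.hasSum.prod_fiberwise hrow
  rw [← this.unique hcol]
  exact hsum.hasSum

/-! ### The frame property -/

theorem isGaborFrame_bsplineWindow_two {β : ℝ} (hβ : 0 < β) (hβ2 : β < 2) {α : ℝ} (hα : 0 < α)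
    (hαM : α < 1 / (2 * √(bernsteinConst (bsplineWindow 2) (1 / β)))) :
    IsGaborFrame (bsplineWindow 2) α β := by
  obtain ⟨A, B, hA, hB, hfib⟩ := exists_fiber_bounds hβ hβ2 hα hαM
  have hT : 0 < 1 / β := by positivity
  have hbc := continuous_bsplineWindow_two
  refine ⟨memLp_gaborAtom α β, ?_⟩
  set D : Set (Lp ℂ 2 (volume : Measure ℝ)) :=
    {d | ∃ (f : ℝ → ℂ) (hf : MemLp f 2 volume), Continuous f ∧ HasCompactSupport f ∧
      d = hf.toLp f} with hDdef
  have hD : Dense D := by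
    intro u
    rw [Metric.mem_closure_iff]
    intro ε hε
    obtain ⟨g, hgc, hgle, hg, hgm⟩ := (Lp.memLp u).exists_hasCompactSupport_eLpNorm_sub_le
      (by simp) (ε := ENNReal.ofReal (ε / 2)) (by simpa using hε)
    refine ⟨hgm.toLp g, ⟨g, hgm, hg, hgc, rfl⟩, ?_⟩
    rw [dist_eq_norm]
    have e : u - hgm.toLp g = ((Lp.memLp u).sub hgm).toLp (⇑u - g) := by
      rw [MemLp.toLp_sub (Lp.memLp u) hgm, Lp.toLp_coeFn]
    rw [e, Lp.norm_toLp]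
    refine (ENNReal.toReal_le_of_le_ofReal (by positivity) hgle).trans_lt (half_lt_self hε)
  refine isHilbertFrame_of_dense hD (A := 1 / β * A) (B := 1 / β * B) (by positivity)
    (by positivity) ?_
  rintro _ ⟨f, hfm, hf, hfc, rfl⟩
  obtain ⟨S, hnorm, K, hKz, hsum⟩ := hasSum_sq_gabor_coeff hβ hα hf hfc
  have hinner (p : ℤ × ℤ) : inner ℂ ((memLp_gaborAtom α β p.1 p.2).toLp
      (gaborAtom (bsplineWindow 2) α β p.1 p.2)) (hfm.toLp f)
      = ∫ x, starRingEnd ℂ (gaborAtom (bsplineWindow 2) α β p.1 p.2 x) * f x := by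
    rw [L2.inner_def]
    refine integral_congr_ae ?_
    filter_upwards [(memLp_gaborAtom α β p.1 p.2).coeFn_toLp, hfm.coeFn_toLp] with x h1 h2
    rw [h1, h2, RCLike.inner_apply']
  have hnormf : ‖hfm.toLp f‖ ^ 2 = ∫ x, ‖f x‖ ^ 2 := by
    rw [← RCLike.ofReal_re (K := ℂ) (‖hfm.toLp f‖ ^ 2)]
    push_cast
    rw [← inner_self_eq_norm_sq_to_K (𝕜 := ℂ), L2.inner_def,
      ← integral_re (L2.integrable_inner _ _)]
    refine integral_congr_ae ?_
    filter_upwards [hfm.coeFn_toLp] with x h2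
    rw [h2, inner_self_eq_norm_sq_to_K (𝕜 := ℂ)]
    norm_cast
  simp only [hinner]
  have hfibx {x : ℝ} (hx : x ∈ Icc 0 (1 / β)) :
      ∑ k ∈ K, ‖∑ l ∈ S, f (x + l * (1 / β)) * bsplineWindow 2 (x + l * (1 / β) - α * k)‖ ^ 2
      = ∑' k : ℤ, ‖∑ l ∈ S, f (x + l * (1 / β))
        * bsplineWindow 2 (x + l * (1 / β) - α * k)‖ ^ 2 := by
    refine (tsum_eq_sum fun k hk => ?_).symm
    rw [hKz x hx k hk, norm_zero, sq, mul_zero]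
  have hi1 (C : ℝ) : IntervalIntegrable (fun x => C * ∑ l ∈ S, ‖f (x + l * (1 / β))‖ ^ 2) volume
      0 (1 / β) := Continuous.intervalIntegrable (by fun_prop) _ _
  have hi2 : IntervalIntegrable (fun x => ∑ k ∈ K, ‖∑ l ∈ S, f (x + l * (1 / β))
      * bsplineWindow 2 (x + l * (1 / β) - α * k)‖ ^ 2) volume 0 (1 / β) :=
    Continuous.intervalIntegrable (by fun_prop) _ _
  refine ⟨hsum.summable, ?_, ?_⟩
  · rw [hsum.tsum_eq, hnormf, hnorm, mul_assoc, ← intervalIntegral.integral_const_mul A]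
    refine mul_le_mul_of_nonneg_left ?_ hT.le
    refine intervalIntegral.integral_mono_on hT.le (hi1 A) hi2 fun x hx => ?_
    rw [hfibx hx]
    exact (hfib S (fun l => f (x + l * (1 / β))) x).1
  · rw [hsum.tsum_eq, hnormf, hnorm, mul_assoc (1 / β), ← intervalIntegral.integral_const_mul B]
    refine mul_le_mul_of_nonneg_left ?_ hT.le
    refine intervalIntegral.integral_mono_on hT.le hi2 (hi1 B) fun x hx => ?_
    rw [hfibx hx]
    exact (hfib S (fun l => f (x + l * (1 / β))) x).2

theorem mainTheorem4 (β : ℝ) (hβ0 : 0 < β) (hβ2 : β < 2) :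
    (∀ w : ℝ, Summable (bernsteinNumTerm (bsplineWindow 2) (1 / β) w) ∧
      Summable (bernsteinDenTerm (bsplineWindow 2) (1 / β) w) ∧
      0 < ∑' l : ℤ, bernsteinDenTerm (bsplineWindow 2) (1 / β) w l) ∧
    IsMaxOn (bernsteinRatio (bsplineWindow 2) (1 / β)) (Icc 0 β) (β / 2) ∧
    bernsteinConst (bsplineWindow 2) (1 / β) =
      1 / (4 * Real.pi ^ 2) *
        ((1 - 2 * bspline 2 (1 / β) + bspline 2 (1 - 1 / β) - bspline 2 (1 - 2 / β)
            + bspline 2 (1 - 3 / β)) /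
          (1 / 3 - bspline 4 (1 / β) + bspline 4 (2 / β) - bspline 4 (3 / β))) ∧
    ∀ α : ℝ, 0 < α → α < 1 / (2 * √(bernsteinConst (bsplineWindow 2) (1 / β))) →
      IsGaborFrame (bsplineWindow 2) α β := by
  refine ⟨fun w => ?_, fun w _ => bernsteinRatio_le hβ0 hβ2 w, bernsteinConst_formula hβ0 hβ2,
    fun α hα hαM => isGaborFrame_bsplineWindow_two hβ0 hβ2 hα hαM⟩
  rw [funext (bernsteinNumTerm_bsplineWindow_two β w),
    funext (bernsteinDenTerm_bsplineWindow_two β w)]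
  exact ⟨summable_sq_mul_sinc_pow_four hβ0 w, summable_sinc_pow_four hβ0 w,
    tsum_sinc_pow_four_pos hβ0 hβ2 w⟩
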